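/- Let $\sigma_x,\sigma_r,\sigma_\theta>0$, and let $X\sim\mathcal N(0,\sigma_x^2I_2)$, $V_r\sim\mathcal N(0,\sigma_r^2)$ and $V_\theta\sim\mathcal N(0,\sigma_\theta^2)$ be mutually independent. Put $r_z=\|X\|+V_r$, $\theta_z=\arg(X)+V_\theta$ (a real number, not reduced modulo $2\pi$) and $Z=(r_z\cos\theta_z,\;r_z\sin\theta_z)^\top\in\mathbb R^2$. The conditional law of $X$ given $Z=z$ has a density $p(x\mid Z=z)$ with a version that is jointly continuous in $z\neq0$, $x\neq0$ and is a probability density for every $z\ne 0$; this version is unique at all $z\ne0$, $x\neq0$, and $p(x\mid Z=z)$ denotes it. Let $g^*(z)=\int x\,p(x\mid Z=z)\,dx$ (the integral converges absolutely for every $z\neq0$); this is the Bayes estimator, i.e. $g^*(Z)=\mathbb E[X\mid Z]$ almost surely. Write $u_\beta=(\cos\beta,\sin\beta)^\top$. Then: 1. for every $z\neq0$, the posterior $p(x\mid Z=z)$ is not Gaussian in $x$; 2. there is a function $q:(0,\infty)\to\mathbb R$ with $g^*(Ru_\beta)=q(R)\,u_\beta$ for all $R>0$ and $\beta\in\mathbb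 R$, and $$\lim_{R\downarrow0}\frac{q(R)}{R}=\frac{2e^{-\sigma_\theta^2/2}\sigma_x^2}{\sigma_x^2+\sigma_r^2},\qquad \lim_{R\to\infty}\frac{q(R)}{R}=\frac{e^{-\sigma_\theta^2/2}\sigma_x^2}{\sigma_x^2+\sigma_r^2};$$ these limits differ, and $g^*$ is not affine: for no $a\in\mathbb R^2$, $B\in\mathbb R^{2\times2}$ does $g^*(z)=a+Bz$ hold for almost every $z$ with respect to the law of $Z$; 3. $X-g^*(Z)$ and all $X-(a+BZ)$ are square integrable, and $$\inf_{a\in\mathbb R^2,\;B\in\mathbb R^{2\times2}}\mathbb E\|X-(a+BZ)\|^2\;>\;\mathbb E\|X-g^*(Z)\|^2 .$$ In particular every affine estimator $a+BZ$ has strictly larger mean squared error than the Bayes estimator. -/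

import Mathlib

open MeasureTheory ProbabilityTheory Filter Topology

namespace Lidar

/-- The Euclidean plane. -/
abbrev Plane : Type := EuclideanSpace ℝ (Fin 2)

/-- The unit vector `u_β = (cos β, sin β)`. -/
noncomputable def unitVec (β : ℝ) : Plane := !₂[Real.cos β, Real.sin β]

/-- The true angle `arg x ∈ (-π, π]` of a point of the plane. -/
noncomputable def angle (x : Plane) : ℝ := Complex.arg ⟨x 0, x 1⟩

/-- The reported Cartesian measurement `Z = (r_z cos θ_z, r_z sin θ_z)`, where
`r_z = ‖x‖ + v` is the noisy range and `θ_z = arg x + w` is the noisy (real-valued) bearing. -/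
noncomputable def measurement (x : Plane) (v w : ℝ) : Plane :=
  !₂[(‖x‖ + v) * Real.cos (angle x + w), (‖x‖ + v) * Real.sin (angle x + w)]

/-- `p z x` is the posterior density `p(x ∣ Z = z)`: for almost every value `z` of `Z` it is the
Lebesgue density of the regular conditional distribution of `X` given `Z = z`. So that single
values `z` have a meaning, it is the version that is jointly continuous in `z ≠ 0`, `x ≠ 0`, and
for each `z ≠ 0` it is a probability density. -/
structure IsPosteriorDensity {Ω : Type*} [MeasurableSpace Ω] (P : Measure Ω) [IsFiniteMeasure P]
    (X Z : Ω → Plane) (p : Plane → Plane → ℝ) : Prop where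
  nonneg : ∀ z x, 0 ≤ p z x
  continuousOn : ContinuousOn (fun zx : Plane × Plane => p zx.1 zx.2)
    {zx : Plane × Plane | zx.1 ≠ 0 ∧ zx.2 ≠ 0}
  lintegral_eq_one : ∀ z, z ≠ 0 → ∫⁻ x, ENNReal.ofReal (p z x) = 1
  condDistrib_eq : ∀ᵐ z ∂(P.map Z),
    condDistrib X Z P z = (volume : Measure Plane).withDensity (fun x => ENNReal.ofReal (p z x))

/-- The posterior distribution of `X` given `Z = z`, with density `p z`. -/
noncomputable def posterior (p : Plane → Plane → ℝ) (z : Plane) : Measure Plane :=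
  (volume : Measure Plane).withDensity (fun x => ENNReal.ofReal (p z x))

/-- The Bayes estimator `g*(z) = E[X ∣ Z = z]`, the mean of the posterior density at `z`. -/
noncomputable def bayesEstimator (p : Plane → Plane → ℝ) (z : Plane) : Plane :=
  ∫ x, p z x • x

/-- The affine estimator `z ↦ a + B z`. -/
noncomputable def affineEstimator (a : Plane) (B : Matrix (Fin 2) (Fin 2) ℝ) (z : Plane) : Plane :=
  a + Matrix.toEuclideanLin B z

/-- The mean squared error `E ‖X - f(Z)‖²` of the estimator `f`. -/
noncomputable def mse {Ω : Type*} [MeasurableSpace Ω] (P : Measure Ω)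
    (X Z : Ω → Plane) (f : Plane → Plane) : ℝ :=
  ∫ ω, ‖X ω - f (Z ω)‖ ^ 2 ∂P

end Lidar

namespace Lidar

/-! A measurement `z` comes from the signed range `‖z‖` at bearing `angle z`, or from `-‖z‖` at the
opposite bearing. Completing the square in the range shows that, given `Z = z`, the position is
distributed as `s • unitVec (angle z + w)` with `s` and `w` independent. Here `w` has the bearing
noise law, and `s` has density proportional to `|s|` with respect to `N(k‖z‖, τ)`, where `k = σx² /
(σx² + σr²)` and `τ = σx² σr² / (σx² + σr²)`; the weight `|s|` is the polar Jacobian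
(`bayes_formula`, `posterior_posteriorDensity`).

Moments of projections of the posterior therefore factor into a radial and an angular part. A
Gaussian satisfies `E Y⁴ = 3 (E Y²)² - 2 (E Y)⁴` in every direction, and three directions already
contradict this (`not_isGaussian_posterior`).

The posterior mean is radial, with `q(R) = exp(-σθ² / 2) E(|Y| Y) / E|Y|` for `Y ∼ N(kR, τ)`. For a
small mean `μ`, `E(|Y| Y)` is approximately `2 μ E|Y|`; for a large one it is approximately `μ
E|Y|`. Hence `q(R) / R` has limits differing by a factor 2, which no affine map allows
(`not_ae_eq_affineEstimator`).

By Pythagoras in `L²` the excess error of an affine estimator is its squared distance to `g*(Z)`.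
The affine estimators form a finite-dimensional, hence closed, subspace not containing `g*(Z)`, so
the infimum of this excess is positive. -/

/-! ### The wrapped Gaussian density and integrals of periodic functions. -/

/-- The density of a centered Gaussian of variance `v` reduced modulo `2π`. -/
noncomputable def wrappedPDF (v : NNReal) (t : ℝ) : ℝ :=
  ∑' k : ℤ, gaussianPDFReal 0 v (t + k * (2 * Real.pi))

/-- Separates the variables, so that the wrapped series has a summable majorant uniform for bounded
`t`. The gap between the exponents is the square `(2t + y)² / (4v)`. -/
lemma gaussianPDFReal_zero_add_le {v : NNReal} (hv : v ≠ 0) (t y : ℝ) :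
    gaussianPDFReal 0 v (t + y) ≤
      (√(2 * Real.pi * v))⁻¹ * Real.exp (t ^ 2 / (2 * v)) * Real.exp (-(y ^ 2 / (4 * v))) := by
  have hv' : (0 : ℝ) < v := by positivity
  rw [gaussianPDFReal, mul_assoc (_⁻¹) (Real.exp _) (Real.exp _), ← Real.exp_add]
  gcongr
  rw [← sub_nonneg]
  have : t ^ 2 / (2 * v) + -(y ^ 2 / (4 * v)) - -(t + y - 0) ^ 2 / (2 * v) =
      (2 * t + y) ^ 2 / (4 * v) := by field_simp; ring
  rw [this]
  positivity

lemma summable_exp_neg_sq_int {c : ℝ} (hc : 0 < c) :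
    Summable fun k : ℤ => Real.exp (-(c * (k : ℝ) ^ 2)) := by
  -- The theta-series majorant with zero linear term and exponent `π T k²`, so `T = c / π`.
  have := summable_pow_mul_jacobiTheta₂_term_bound 0 (T := c / Real.pi) (by positivity) 0
  refine this.congr fun k => ?_
  simp only [pow_zero, one_mul]
  congr 1
  field_simp
  ring

lemma summable_gaussianPDFReal_bound {v : NNReal} (hv : v ≠ 0) (M : ℝ) :
    Summable fun k : ℤ => (√(2 * Real.pi * v))⁻¹ * Real.exp (M ^ 2 / (2 * v)) *
      Real.exp (-((k * (2 * Real.pi)) ^ 2 / (4 * v))) := by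
  have hv' : (0 : ℝ) < v := by positivity
  refine Summable.mul_left _ ((summable_exp_neg_sq_int
    (c := Real.pi ^ 2 / v) (by positivity)).congr fun k => ?_)
  congr 1
  field_simp
  ring

lemma summable_gaussianPDFReal_add_int {v : NNReal} (hv : v ≠ 0) (t : ℝ) :
    Summable fun k : ℤ => gaussianPDFReal 0 v (t + k * (2 * Real.pi)) :=
  (summable_gaussianPDFReal_bound hv t).of_nonneg_of_le
    (fun _ => gaussianPDFReal_nonneg _ _ _) fun _ => gaussianPDFReal_zero_add_le hv _ _

lemma continuous_gaussianPDFReal (μ : ℝ) (v : NNReal) : Continuous (gaussianPDFReal μ v) := by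
  unfold gaussianPDFReal
  fun_prop

lemma continuous_wrappedPDF {v : NNReal} (hv : v ≠ 0) : Continuous (wrappedPDF v) := by
  have hv' : (0 : ℝ) < v := by positivity
  rw [continuous_iff_continuousAt]
  intro t
  have h : ContinuousOn (wrappedPDF v) (Metric.ball 0 (|t| + 1)) := by
    refine continuousOn_tsum (fun k => ?_) (summable_gaussianPDFReal_bound hv (|t| + 1)) ?_
    · exact ((continuous_gaussianPDFReal 0 v).comp (by fun_prop)).continuousOn
    · intro k x hx
      rw [Real.norm_of_nonneg (gaussianPDFReal_nonneg _ _ _)]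
      refine (gaussianPDFReal_zero_add_le hv _ _).trans ?_
      have : x ^ 2 ≤ (|t| + 1) ^ 2 := by
        rw [← sq_abs x]
        have := mem_ball_zero_iff.1 hx
        rw [Real.norm_eq_abs] at this
        gcongr
      gcongr
  exact h.continuousAt (Metric.isOpen_ball.mem_nhds (by simp))

lemma wrappedPDF_nonneg (v : NNReal) (t : ℝ) : 0 ≤ wrappedPDF v t :=
  tsum_nonneg fun _ => gaussianPDFReal_nonneg _ _ _

lemma wrappedPDF_periodic (v : NNReal) : Function.Periodic (wrappedPDF v) (2 * Real.pi) := by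
  intro t
  unfold wrappedPDF
  rw [← (Equiv.addRight (1 : ℤ)).tsum_eq fun k : ℤ => gaussianPDFReal 0 v (t + k * (2 * Real.pi))]
  refine tsum_congr fun k => ?_
  simp only [Equiv.coe_addRight]
  push_cast
  ring_nf

lemma wrappedPDF_neg (v : NNReal) (t : ℝ) : wrappedPDF v (-t) = wrappedPDF v t := by
  unfold wrappedPDF
  rw [← (Equiv.neg ℤ).tsum_eq fun k : ℤ => gaussianPDFReal 0 v (t + k * (2 * Real.pi))]
  refine tsum_congr fun k => ?_
  simp only [Equiv.neg_apply, gaussianPDFReal]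
  push_cast
  ring_nf

/-- The line is tiled by the translates of one period, and each tile is shifted back. -/
lemma lintegral_eq_lintegral_Ioc_tsum {f : ℝ → ENNReal} (hf : Measurable f) {T : ℝ} (hT : 0 < T)
    (a : ℝ) : ∫⁻ x, f x = ∫⁻ x in Set.Ioc a (a + T), ∑' k : ℤ, f (x + k * T) := by
  rw [lintegral_tsum fun k => (by fun_prop), ← setLIntegral_univ, ← iUnion_Ioc_add_zsmul hT a,
    lintegral_iUnion (fun _ => measurableSet_Ioc) (Set.pairwise_disjoint_Ioc_add_zsmul a T)]
  refine tsum_congr fun k => ?_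
  have h := (measurePreserving_add_right (volume : Measure ℝ) ((k : ℝ) * T)).setLIntegral_comp_emb
    (measurableEmbedding_addRight _) f (Set.Ioc a (a + T))
  rw [h]
  congr 2
  simp only [Set.image_add_const_Ioc, zsmul_eq_mul]
  push_cast
  ring_nf

lemma ofReal_wrappedPDF {v : NNReal} (hv : v ≠ 0) (t : ℝ) :
    ENNReal.ofReal (wrappedPDF v t) =
      ∑' k : ℤ, gaussianPDF 0 v (t + k * (2 * Real.pi)) :=
  ENNReal.ofReal_tsum_of_nonneg (fun _ => gaussianPDFReal_nonneg _ _ _)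
    (summable_gaussianPDFReal_add_int hv t)

lemma lintegral_gaussianReal_periodic {v : NNReal} (hv : v ≠ 0) {f : ℝ → ENNReal}
    (hf : Measurable f) (hper : Function.Periodic f (2 * Real.pi)) (β : ℝ) :
    ∫⁻ w, f (β + w) ∂(gaussianReal 0 v) =
      ∫⁻ θ in Set.Ioc (-Real.pi) Real.pi, ENNReal.ofReal (wrappedPDF v (θ - β)) * f θ := by
  have hm := measurable_gaussianPDF 0 v
  rw [gaussianReal_of_var_ne_zero _ hv,
    lintegral_withDensity_eq_lintegral_mul _ hm (by fun_prop)]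
  simp only [Pi.mul_apply]
  rw [← lintegral_sub_right_eq_self _ β,
    lintegral_eq_lintegral_Ioc_tsum (by fun_prop) Real.two_pi_pos (-Real.pi)]
  have : -Real.pi + 2 * Real.pi = Real.pi := by ring
  rw [this]
  refine lintegral_congr fun θ => ?_
  rw [ofReal_wrappedPDF hv, ← ENNReal.tsum_mul_right]
  refine tsum_congr fun k => ?_
  congr 1
  · congr 1; ring
  · rw [← hper.int_mul k θ]; congr 1; ring

/-! ### Polar coordinates in the plane. -/

@[fun_prop]
lemma measurable_angle : Measurable angle := by
  have : angle = fun x : Plane => Complex.arg (Complex.measurableEquivRealProd.symm (x 0, x 1)) := by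
    ext x; rfl
  rw [this]
  exact Complex.measurable_arg.comp
    (Complex.measurableEquivRealProd.symm.measurable.comp (by fun_prop))

@[fun_prop]
lemma continuous_unitVec : Continuous unitVec := by
  unfold unitVec
  have : Continuous fun β : ℝ => ![Real.cos β, Real.sin β] := by
    refine continuous_pi fun i => ?_
    fin_cases i <;> simp <;> fun_prop
  exact (PiLp.continuous_toLp 2 _).comp this

@[fun_prop]
lemma measurable_unitVec : Measurable unitVec := continuous_unitVec.measurable

@[simp] lemma unitVec_zero' (β : ℝ) : unitVec β 0 = Real.cos β := rfl
@[simp] lemma unitVec_one' (β : ℝ) : unitVec β 1 = Real.sin β := rfl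

lemma norm_unitVec (β : ℝ) : ‖unitVec β‖ = 1 := by
  simp [EuclideanSpace.norm_eq, Fin.sum_univ_two]

lemma unitVec_periodic : Function.Periodic unitVec (2 * Real.pi) := by
  intro β
  simp [unitVec]

lemma unitVec_add_pi (β : ℝ) : unitVec (β + Real.pi) = -unitVec β := by
  ext i
  fin_cases i <;> simp

lemma measurement_eq (x : Plane) (v w : ℝ) :
    measurement x v w = (‖x‖ + v) • unitVec (angle x + w) := by
  ext i
  fin_cases i <;> simp [measurement]

lemma norm_smul_unitVec_angle (x : Plane) : ‖x‖ • unitVec (angle x) = x := by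
  have hn : ‖x‖ = ‖(⟨x 0, x 1⟩ : ℂ)‖ := by
    rw [EuclideanSpace.norm_eq, Complex.norm_eq_sqrt_sq_add_sq]
    simp [Fin.sum_univ_two]
  ext i
  fin_cases i
  · simp [hn, angle]
  · simp [hn, angle]

lemma norm_smul_unitVec {r : ℝ} (hr : 0 < r) (θ : ℝ) : ‖r • unitVec θ‖ = r := by
  rw [norm_smul, norm_unitVec, mul_one, Real.norm_of_nonneg hr.le]

lemma angle_smul_unitVec {r : ℝ} (hr : 0 < r) {θ : ℝ} (hθ : θ ∈ Set.Ioc (-Real.pi) Real.pi) :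
    angle (r • unitVec θ) = θ := by
  refine Eq.trans ?_ (Complex.arg_mul_cos_add_sin_mul_I hr hθ)
  rw [angle]
  congr 1
  apply Complex.ext
  · simp [Complex.cos_ofReal_re]
  · simp [Complex.sin_ofReal_re]

lemma lintegral_plane_polar {f : Plane → ENNReal} (hf : Measurable f) :
    ∫⁻ z, f z = ∫⁻ r in Set.Ioi (0 : ℝ), ∫⁻ θ in Set.Ioc (-Real.pi) Real.pi,
      ENNReal.ofReal r * f (r • unitVec θ) := by
  rw [← (Complex.orthonormalBasisOneI.measurePreserving_repr).lintegral_comp hf,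
    ← Complex.lintegral_comp_polarCoord_symm, polarCoord_target, Measure.volume_eq_prod,
    ← Measure.prod_restrict]
  have key (p : ℝ × ℝ) : Complex.orthonormalBasisOneI.repr (Complex.polarCoord.symm p) =
      p.1 • unitVec p.2 := by
    ext i
    fin_cases i <;> simp [Complex.polarCoord_symm_apply, Complex.cos_ofReal_re,
      Complex.sin_ofReal_re]
  simp only [key, smul_eq_mul]
  rw [lintegral_prod _ (by fun_prop)]
  simp only [restrict_Ioo_eq_restrict_Ioc]

lemma lintegral_eq_lintegral_Ioi_add_neg {f : ℝ → ENNReal} (hf : Measurable f) :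
    ∫⁻ r, f r = ∫⁻ r in Set.Ioi (0 : ℝ), (f r + f (-r)) := by
  rw [lintegral_add_left hf, ← lintegral_add_compl f measurableSet_Ioi (A := Set.Ioi (0 : ℝ))]
  congr 1
  have h := (Measure.measurePreserving_neg (volume : Measure ℝ)).setLIntegral_comp_emb
    (MeasurableEquiv.neg ℝ).measurableEmbedding f (Set.Ioi 0)
  rw [h, Set.compl_Ioi]
  simp only [Set.image_neg_eq_neg, Set.neg_Ioi, neg_zero]
  exact setLIntegral_congr Iio_ae_eq_Iic.symm

/-- If `R` has density `g` on the line and `w` is an independent centered Gaussian angle,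
then `R u_{β + w}` has the density displayed on the right. -/
lemma lintegral_smul_unitVec_gaussian {v : NNReal} (hv : v ≠ 0) {g : ℝ → ENNReal}
    (hg : Measurable g) {f : Plane → ENNReal} (hf : Measurable f) (β : ℝ) :
    ∫⁻ r, g r * ∫⁻ w, f (r • unitVec (β + w)) ∂(gaussianReal 0 v) =
      ∫⁻ z, f z * ((g ‖z‖ * ENNReal.ofReal (wrappedPDF v (angle z - β)) +
        g (-‖z‖) * ENNReal.ofReal (wrappedPDF v (angle z - β + Real.pi))) /
          ENNReal.ofReal ‖z‖) := by
  have hW : Measurable (wrappedPDF v) := (continuous_wrappedPDF hv).measurable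
  rw [lintegral_eq_lintegral_Ioi_add_neg (by fun_prop), lintegral_plane_polar (by fun_prop)]
  refine setLIntegral_congr_fun measurableSet_Ioi fun r hr => ?_
  have hr : 0 < r := hr
  have h1 := lintegral_gaussianReal_periodic hv (f := fun θ => f (r • unitVec θ)) (by fun_prop)
    (fun θ => by simp [unitVec_periodic θ]) β
  have h2 := lintegral_gaussianReal_periodic hv (f := fun θ => f (r • unitVec θ)) (by fun_prop)
    (fun θ => by simp [unitVec_periodic θ]) (β + Real.pi)
  -- Negative ranges are reflected to positive ones by turning the bearing through `π`.
  have h3 (w : ℝ) : (-r) • unitVec (β + w) = r • unitVec (β + Real.pi + w) := by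
    rw [add_right_comm, unitVec_add_pi]; simp
  simp only [h3]
  rw [h1, h2, ← lintegral_const_mul _ (by fun_prop), ← lintegral_const_mul _ (by fun_prop),
    ← lintegral_add_left (by fun_prop)]
  refine setLIntegral_congr_fun measurableSet_Ioc fun θ hθ => ?_
  simp only [norm_smul_unitVec hr, angle_smul_unitVec hr hθ]
  have h4 : wrappedPDF v (θ - (β + Real.pi)) = wrappedPDF v (θ - β + Real.pi) := by
    rw [← wrappedPDF_periodic v (θ - (β + Real.pi))]; congr 1; ring
  -- The polar Jacobian `r` cancels the division by `‖z‖`.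
  rw [h4, mul_left_comm (ENNReal.ofReal r), ENNReal.mul_div_cancel (by simpa using hr) (by simp)]
  ring

/-! ### Absolute moments and the law of the signed range. -/

/-- The first absolute moment `E |Y|` of `Y ∼ N(μ, τ)`. -/
noncomputable def absMean (τ : NNReal) (μ : ℝ) : ℝ := ∫ y, |y| ∂(gaussianReal μ τ)

lemma integrable_abs_pow_gaussianReal (μ : ℝ) (τ : NNReal) (n : ℕ) :
    Integrable (fun y => |y| ^ n) (gaussianReal μ τ) := by
  simpa using (memLp_id_gaussianReal (μ := μ) (v := τ) n).integrable_norm_pow'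

lemma integrable_abs_gaussianReal (μ : ℝ) (τ : NNReal) :
    Integrable (fun y => |y|) (gaussianReal μ τ) := by
  simpa using integrable_abs_pow_gaussianReal μ τ 1

lemma integral_gaussianReal_eq_integral_add (μ : ℝ) (τ : NNReal) {f : ℝ → ℝ}
    (hf : Continuous f) :
    ∫ y, f y ∂(gaussianReal μ τ) = ∫ y, f (μ + y) ∂(gaussianReal 0 τ) := by
  have h := gaussianReal_map_const_add (μ := 0) (v := τ) μ
  rw [zero_add] at h
  rw [← h, integral_map (by fun_prop) hf.aestronglyMeasurable]

lemma integrable_add_gaussianReal (μ : ℝ) (τ : NNReal) {f : ℝ → ℝ}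
    (hf : Continuous f) (h : Integrable f (gaussianReal μ τ)) :
    Integrable (fun y => f (μ + y)) (gaussianReal 0 τ) := by
  have hm := gaussianReal_map_const_add (μ := 0) (v := τ) μ
  rw [zero_add] at hm
  rw [← hm, integrable_map_measure hf.aestronglyMeasurable (by fun_prop)] at h
  exact h

lemma absMean_pos {τ : NNReal} (hτ : τ ≠ 0) (μ : ℝ) : 0 < absMean τ μ := by
  rw [absMean, integral_pos_iff_support_of_nonneg (fun _ => abs_nonneg _)
    (integrable_abs_gaussianReal μ τ)]
  have : Function.support (fun y : ℝ => |y|) = {0}ᶜ := by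
    ext y; simp
  have := nullSingletonClass_gaussianReal (μ := μ) hτ
  rw [‹Function.support _ = _›, prob_compl_eq_one_sub (measurableSet_singleton _)]
  simp

/-- Both means are written over the same centered Gaussian, where the integrands differ by at most
`|μ - ν|`. -/
lemma abs_absMean_sub_le (τ : NNReal) (μ ν : ℝ) :
    |absMean τ μ - absMean τ ν| ≤ |μ - ν| := by
  rw [absMean, absMean, integral_gaussianReal_eq_integral_add μ τ continuous_abs,
    integral_gaussianReal_eq_integral_add ν τ continuous_abs, ← integral_sub
      (integrable_add_gaussianReal μ τ continuous_abs (integrable_abs_gaussianReal μ τ))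
      (integrable_add_gaussianReal ν τ continuous_abs (integrable_abs_gaussianReal ν τ))]
  refine (abs_integral_le_integral_abs).trans ?_
  refine (integral_mono_of_nonneg (ae_of_all _ fun _ => abs_nonneg _)
    (integrable_const |μ - ν|) (ae_of_all _ fun y => ?_)).trans (by simp)
  refine (abs_abs_sub_abs_le_abs_sub _ _).trans ?_
  simp

@[fun_prop]
lemma continuous_absMean (τ : NNReal) : Continuous (absMean τ) := by
  refine (LipschitzWith.of_dist_le' (K := 1) fun μ ν => ?_).continuous
  rw [Real.dist_eq, Real.dist_eq, one_mul]
  exact abs_absMean_sub_le τ μ ν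

/-- The law with density proportional to `|s|` with respect to `N(μ, τ)`. -/
noncomputable def signedRangeLaw (τ : NNReal) (μ : ℝ) : Measure ℝ :=
  (gaussianReal μ τ).withDensity fun s => ENNReal.ofReal (|s| / absMean τ μ)

lemma isProbabilityMeasure_signedRangeLaw {τ : NNReal} (hτ : τ ≠ 0) (μ : ℝ) :
    IsProbabilityMeasure (signedRangeLaw τ μ) := by
  refine ⟨?_⟩
  have hA := absMean_pos hτ μ
  rw [signedRangeLaw, withDensity_apply _ MeasurableSet.univ, setLIntegral_univ,
    ← ofReal_integral_eq_lintegral_ofReal ((integrable_abs_gaussianReal μ τ).div_const _)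
      (ae_of_all _ fun _ => by positivity), integral_div]
  change ENNReal.ofReal (absMean τ μ / absMean τ μ) = 1
  rw [div_self hA.ne', ENNReal.ofReal_one]

lemma integral_signedRangeLaw {τ : NNReal} (hτ : τ ≠ 0) (μ : ℝ) (f : ℝ → ℝ) :
    ∫ s, f s ∂(signedRangeLaw τ μ) = (∫ s, |s| * f s ∂(gaussianReal μ τ)) / absMean τ μ := by
  have hA := absMean_pos hτ μ
  rw [signedRangeLaw, integral_withDensity_eq_integral_toReal_smul (by fun_prop)
    (ae_of_all _ fun _ => by simp), ← integral_div]
  refine integral_congr_ae (ae_of_all _ fun s => ?_)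
  simp only [smul_eq_mul]
  rw [ENNReal.toReal_ofReal (by positivity)]
  ring

lemma integrable_signedRangeLaw {τ : NNReal} (hτ : τ ≠ 0) {μ : ℝ} {f : ℝ → ℝ}
    (hf : Integrable (fun s => |s| * f s) (gaussianReal μ τ)) :
    Integrable f (signedRangeLaw τ μ) := by
  have hA := absMean_pos hτ μ
  rw [signedRangeLaw, integrable_withDensity_iff_integrable_smul' (by fun_prop)
    (ae_of_all _ fun _ => by simp)]
  refine (hf.div_const (absMean τ μ)).congr (ae_of_all _ fun s => ?_)
  simp only [smul_eq_mul]
  rw [ENNReal.toReal_ofReal (by positivity)]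
  ring

lemma integrable_abs_pow_signedRangeLaw {τ : NNReal} (hτ : τ ≠ 0) (μ : ℝ) (n : ℕ) :
    Integrable (fun s => |s| ^ n) (signedRangeLaw τ μ) :=
  integrable_signedRangeLaw hτ
    ((integrable_abs_pow_gaussianReal μ τ (n + 1)).congr (ae_of_all _ fun _ => pow_succ' _ _))

lemma integrable_pow_signedRangeLaw {τ : NNReal} (hτ : τ ≠ 0) (μ : ℝ) (n : ℕ) :
    Integrable (fun s => s ^ n) (signedRangeLaw τ μ) :=
  (integrable_abs_pow_signedRangeLaw hτ μ n).mono' (by fun_prop)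
    (ae_of_all _ fun s => by simp)

/-! ### The posterior density, its continuity and its polar representation. -/

/-- The density of the posterior of the position given the measurement `z`, where `k` is the
gain, `τ` the variance of the range and `v` the variance of the bearing. -/
noncomputable def posteriorDensity (k : ℝ) (τ v : NNReal) (z x : Plane) : ℝ :=
  (gaussianPDFReal (k * ‖z‖) τ ‖x‖ * wrappedPDF v (angle x - angle z) +
    gaussianPDFReal (k * ‖z‖) τ (-‖x‖) * wrappedPDF v (angle x - angle z + Real.pi)) /
    absMean τ (k * ‖z‖)

lemma absMean_nonneg (τ : NNReal) (μ : ℝ) : 0 ≤ absMean τ μ :=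
  integral_nonneg fun _ => abs_nonneg _

lemma posteriorDensity_nonneg (k : ℝ) (τ v : NNReal) (z x : Plane) :
    0 ≤ posteriorDensity k τ v z x :=
  div_nonneg (add_nonneg (mul_nonneg (gaussianPDFReal_nonneg _ _ _) (wrappedPDF_nonneg _ _))
    (mul_nonneg (gaussianPDFReal_nonneg _ _ _) (wrappedPDF_nonneg _ _))) (absMean_nonneg _ _)

lemma continuous_gaussianPDFReal_mean (τ : NNReal) :
    Continuous fun p : ℝ × ℝ => gaussianPDFReal p.1 τ p.2 := by
  unfold gaussianPDFReal
  fun_prop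

lemma Continuous.gaussianPDFReal_comp {α : Type*} [TopologicalSpace α] (τ : NNReal)
    {f g : α → ℝ} (hf : Continuous f) (hg : Continuous g) :
    Continuous fun a => gaussianPDFReal (f a) τ (g a) :=
  (continuous_gaussianPDFReal_mean τ).comp (hf.prodMk hg)

lemma measurable_posteriorDensity (k : ℝ) (τ : NNReal) {v : NNReal} (hv : v ≠ 0) :
    Measurable fun zx : Plane × Plane => posteriorDensity k τ v zx.1 zx.2 := by
  have hW := (continuous_wrappedPDF hv).measurable
  have h1 : Measurable fun zx : Plane × Plane => gaussianPDFReal (k * ‖zx.1‖) τ ‖zx.2‖ :=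
    (Continuous.gaussianPDFReal_comp τ (by fun_prop) (by fun_prop)).measurable
  have h2 : Measurable fun zx : Plane × Plane => gaussianPDFReal (k * ‖zx.1‖) τ (-‖zx.2‖) :=
    (Continuous.gaussianPDFReal_comp τ (by fun_prop) (by fun_prop)).measurable
  have hA := (continuous_absMean τ).measurable
  unfold posteriorDensity
  fun_prop

lemma measurable_posteriorDensity_right (k : ℝ) (τ : NNReal) {v : NNReal} (hv : v ≠ 0)
    (z : Plane) : Measurable (posteriorDensity k τ v z) :=
  Measurable.of_uncurry_left (f := posteriorDensity k τ v) (measurable_posteriorDensity k τ hv)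

/-- The jump of `arg` across the negative axis is `2π` and disappears in the circle. -/
lemma continuousAt_coe_angle {x : Plane} (hx : x ≠ 0) :
    ContinuousAt (fun x : Plane => (angle x : Real.Angle)) x := by
  have h0 : (⟨x 0, x 1⟩ : ℂ) ≠ 0 := by
    intro h
    apply hx
    ext i
    fin_cases i
    · exact congrArg Complex.re h
    · exact congrArg Complex.im h
  have hp : Continuous fun x : Plane => (x 0, x 1) := by fun_prop
  have hc : Continuous fun x : Plane => (⟨x 0, x 1⟩ : ℂ) :=
    Complex.equivRealProdCLM.symm.continuous.comp hp
  exact ContinuousAt.comp (f := fun x : Plane => (⟨x 0, x 1⟩ : ℂ))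
    (Complex.continuousAt_arg_coe_angle h0) hc.continuousAt

lemma continuousAt_wrappedPDF_angle_sub {v : NNReal} (hv : v ≠ 0) (c : ℝ) {z x : Plane}
    (hz : z ≠ 0) (hx : x ≠ 0) :
    ContinuousAt (fun zx : Plane × Plane => wrappedPDF v (angle zx.2 - angle zx.1 + c)) (z, x) := by
  -- By periodicity the wrapped density is a continuous function on the circle, so only angles
  -- modulo `2π` matter.
  have hF : Continuous ((wrappedPDF_periodic v).lift : Real.Angle → ℝ) :=
    (continuous_wrappedPDF hv).quotient_liftOn' _
  have h (zx : Plane × Plane) : wrappedPDF v (angle zx.2 - angle zx.1 + c) =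
      (wrappedPDF_periodic v).lift
        ((angle zx.2 : Real.Angle) - (angle zx.1 : Real.Angle) + (c : Real.Angle)) := rfl
  simp only [h]
  have h1 : ContinuousAt (fun zx : Plane × Plane => (angle zx.2 : Real.Angle)) (z, x) :=
    ContinuousAt.comp (f := Prod.snd) (g := fun x : Plane => (angle x : Real.Angle))
      (continuousAt_coe_angle hx) continuousAt_snd
  have h2 : ContinuousAt (fun zx : Plane × Plane => (angle zx.1 : Real.Angle)) (z, x) :=
    ContinuousAt.comp (f := Prod.fst) (g := fun x : Plane => (angle x : Real.Angle))
      (continuousAt_coe_angle hz) continuousAt_fst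
  have h3 : ContinuousAt (fun zx : Plane × Plane => (angle zx.2 : Real.Angle) -
      (angle zx.1 : Real.Angle) + (c : Real.Angle)) (z, x) := (h1.sub h2).add_const _
  exact hF.continuousAt.comp h3

lemma continuousOn_posteriorDensity (k : ℝ) {τ v : NNReal} (hτ : τ ≠ 0) (hv : v ≠ 0) :
    ContinuousOn (fun zx : Plane × Plane => posteriorDensity k τ v zx.1 zx.2)
      {zx : Plane × Plane | zx.1 ≠ 0 ∧ zx.2 ≠ 0} := by
  rintro ⟨z, x⟩ ⟨hz, hx⟩
  refine ContinuousAt.continuousWithinAt ?_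
  have h1 : Continuous fun zx : Plane × Plane => gaussianPDFReal (k * ‖zx.1‖) τ ‖zx.2‖ :=
    Continuous.gaussianPDFReal_comp τ (by fun_prop) (by fun_prop)
  have h2 : Continuous fun zx : Plane × Plane => gaussianPDFReal (k * ‖zx.1‖) τ (-‖zx.2‖) :=
    Continuous.gaussianPDFReal_comp τ (by fun_prop) (by fun_prop)
  have h3 := continuousAt_wrappedPDF_angle_sub hv 0 hz hx
  simp only [add_zero] at h3
  refine ContinuousAt.div ((h1.continuousAt.mul h3).add (h2.continuousAt.mul
    (continuousAt_wrappedPDF_angle_sub hv Real.pi hz hx))) ?_ (absMean_pos hτ _).ne'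
  exact Continuous.continuousAt (by fun_prop)

/-- The weight `|s|` of the signed range law cancels the factor `1 / ‖x‖` produced by polar
coordinates. -/
lemma lintegral_signedRangeLaw_smul_unitVec (k : ℝ) {τ v : NNReal} (hτ : τ ≠ 0) (hv : v ≠ 0)
    (z : Plane) {f : Plane → ENNReal} (hf : Measurable f) :
    ∫⁻ s, ∫⁻ w, f (s • unitVec (angle z + w)) ∂(gaussianReal 0 v)
      ∂(signedRangeLaw τ (k * ‖z‖)) =
    ∫⁻ x, f x * ENNReal.ofReal (posteriorDensity k τ v z x) := by
  have hA := absMean_pos hτ (k * ‖z‖)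
  have hm := measurable_gaussianPDF (k * ‖z‖) τ
  rw [signedRangeLaw, gaussianReal_of_var_ne_zero _ hτ, ← withDensity_mul _ hm (by fun_prop),
    lintegral_withDensity_eq_lintegral_mul _ (by fun_prop) (by fun_prop)]
  simp only [Pi.mul_apply]
  rw [lintegral_smul_unitVec_gaussian hv (g := fun s => gaussianPDF (k * ‖z‖) τ s *
    ENNReal.ofReal (|s| / absMean τ (k * ‖z‖))) (by fun_prop) hf]
  have h0 : ∀ᵐ x : Plane, x ≠ 0 := by
    simp [ae_iff]
  refine lintegral_congr_ae (h0.mono fun x hx => ?_)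
  have hx' : 0 < ‖x‖ := norm_pos_iff.2 hx
  simp only [gaussianPDF, abs_neg, abs_norm]
  congr 1
  have e1 := gaussianPDFReal_nonneg (k * ‖z‖) τ ‖x‖
  have e2 := gaussianPDFReal_nonneg (k * ‖z‖) τ (-‖x‖)
  have e3 := wrappedPDF_nonneg v (angle x - angle z)
  have e4 := wrappedPDF_nonneg v (angle x - angle z + Real.pi)
  rw [← ENNReal.ofReal_mul (by positivity), ← ENNReal.ofReal_mul (by positivity),
    ← ENNReal.ofReal_mul (by positivity), ← ENNReal.ofReal_mul (by positivity),
    ← ENNReal.ofReal_add (by positivity) (by positivity), ← ENNReal.ofReal_div_of_pos hx',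
    posteriorDensity]
  congr 1
  field_simp

/-- The independent range and bearing behind the posterior; total mass, moments and mean are all
read off from this representation. -/
lemma posterior_posteriorDensity (k : ℝ) {τ v : NNReal} (hτ : τ ≠ 0) (hv : v ≠ 0) (z : Plane) :
    posterior (posteriorDensity k τ v) z =
      ((signedRangeLaw τ (k * ‖z‖)).prod (gaussianReal 0 v)).map
        fun p => p.1 • unitVec (angle z + p.2) := by
  have := isProbabilityMeasure_signedRangeLaw hτ (k * ‖z‖)
  have hp := measurable_posteriorDensity_right k τ hv z
  refine Measure.ext_of_lintegral _ fun f hf => ?_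
  rw [lintegral_map hf (by fun_prop), lintegral_prod _ (by fun_prop),
    lintegral_signedRangeLaw_smul_unitVec k hτ hv z hf, posterior,
    lintegral_withDensity_eq_lintegral_mul _ (by fun_prop) hf]
  simp only [Pi.mul_apply, mul_comm]

lemma isProbabilityMeasure_posterior (k : ℝ) {τ v : NNReal} (hτ : τ ≠ 0) (hv : v ≠ 0)
    (z : Plane) : IsProbabilityMeasure (posterior (posteriorDensity k τ v) z) := by
  have := isProbabilityMeasure_signedRangeLaw hτ (k * ‖z‖)
  rw [posterior_posteriorDensity k hτ hv z]
  exact Measure.isProbabilityMeasure_map (by fun_prop)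

/-! ### Moments of projections and failure of Gaussianity. -/

/-- The real part of the Gaussian characteristic function at `t`, rotated by `exp(ic)`. -/
lemma integral_cos_mul_add_gaussianReal (v : NNReal) (t c : ℝ) :
    ∫ w, Real.cos (t * w + c) ∂(gaussianReal 0 v) =
      Real.exp (-(v * t ^ 2 / 2)) * Real.cos c := by
  have h := charFun_gaussianReal (μ := 0) (v := v) t
  rw [charFun_apply_real] at h
  have hi : Integrable (fun w : ℝ => Complex.exp (t * w * Complex.I) * Complex.exp (c * Complex.I))
      (gaussianReal 0 v) := by
    refine (integrable_const (1 : ℝ)).mono' (by fun_prop) (ae_of_all _ fun w => ?_)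
    rw [norm_mul, Complex.norm_exp_ofReal_mul_I, ← Complex.ofReal_mul,
      Complex.norm_exp_ofReal_mul_I, one_mul]
  have hre := Complex.reCLM.integral_comp_comm hi
  rw [integral_mul_const, h] at hre
  have e1 (w : ℝ) : Complex.reCLM (Complex.exp (t * w * Complex.I) * Complex.exp (c * Complex.I)) =
      Real.cos (t * w + c) := by
    rw [← Complex.exp_add, ← add_mul, ← Complex.ofReal_mul, ← Complex.ofReal_add]
    exact Complex.exp_ofReal_mul_I_re _
  simp only [e1] at hre
  rw [hre]
  have e2 : ((t : ℂ) * (0 : ℝ) * Complex.I - v * t ^ 2 / 2) =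
      ((-(v * t ^ 2 / 2) : ℝ) : ℂ) := by
    push_cast; ring
  rw [e2, ← Complex.ofReal_exp, Complex.reCLM_apply, Complex.re_ofReal_mul,
    Complex.exp_ofReal_mul_I_re]

lemma integrable_cos_gaussianReal (v : NNReal) (t c : ℝ) :
    Integrable (fun w => Real.cos (t * w + c)) (gaussianReal 0 v) :=
  (integrable_const (1 : ℝ)).mono' (by fun_prop) (ae_of_all _ fun _ => Real.abs_cos_le_one _)

lemma integral_cos_sub_gaussianReal (v : NNReal) (φ : ℝ) :
    ∫ w, Real.cos (w - φ) ∂(gaussianReal 0 v) = Real.exp (-(v / 2)) * Real.cos φ := by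
  simpa [sub_eq_add_neg] using integral_cos_mul_add_gaussianReal v 1 (-φ)

lemma integral_cos_sub_sq_gaussianReal (v : NNReal) (φ : ℝ) :
    ∫ w, Real.cos (w - φ) ^ 2 ∂(gaussianReal 0 v) =
      (1 + Real.exp (-(2 * v)) * Real.cos (2 * φ)) / 2 := by
  have e (w : ℝ) : Real.cos (w - φ) ^ 2 = 1 / 2 + Real.cos (2 * w + -(2 * φ)) / 2 := by
    rw [Real.cos_sq]; ring_nf
  simp only [e]
  rw [integral_add (integrable_const _) ((integrable_cos_gaussianReal v _ _).div_const _),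
    integral_div _ (fun w => Real.cos (2 * w + -(2 * φ))), integral_cos_mul_add_gaussianReal]
  simp
  ring_nf

lemma integral_cos_sub_pow_four_gaussianReal (v : NNReal) (φ : ℝ) :
    ∫ w, Real.cos (w - φ) ^ 4 ∂(gaussianReal 0 v) =
      (3 + 4 * Real.exp (-(2 * v)) * Real.cos (2 * φ) +
        Real.exp (-(2 * v)) ^ 4 * Real.cos (4 * φ)) / 8 := by
  have e (w : ℝ) : Real.cos (w - φ) ^ 4 =
      3 / 8 + Real.cos (2 * w + -(2 * φ)) / 2 + Real.cos (4 * w + -(4 * φ)) / 8 := by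
    have h2 := Real.cos_sq (w - φ)
    have h4 := Real.cos_sq (2 * (w - φ))
    have h : Real.cos (w - φ) ^ 4 = (Real.cos (w - φ) ^ 2) ^ 2 := by ring
    rw [h, h2, add_sq, div_pow (Real.cos _), h4]
    ring_nf
  simp only [e]
  have i1 := integrable_cos_gaussianReal v 2 (-(2 * φ))
  have i2 := integrable_cos_gaussianReal v 4 (-(4 * φ))
  have i3 : Integrable (fun w => 3 / 8 + Real.cos (2 * w + -(2 * φ)) / 2) (gaussianReal 0 v) :=
    (integrable_const _).add (i1.div_const 2)
  rw [integral_add i3 (i2.div_const 8), integral_add (integrable_const _) (i1.div_const 2),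
    integral_div _ (fun w => Real.cos (2 * w + -(2 * φ))),
    integral_div _ (fun w => Real.cos (4 * w + -(4 * φ))), integral_cos_mul_add_gaussianReal,
    integral_cos_mul_add_gaussianReal, ← Real.exp_nat_mul]
  simp
  ring_nf

lemma iteratedDeriv_gaussian_mgf_four (m V : ℝ) :
    iteratedDeriv 2 (fun t => Real.exp (m * t + V * t ^ 2 / 2)) 0 = m ^ 2 + V ∧
    iteratedDeriv 4 (fun t => Real.exp (m * t + V * t ^ 2 / 2)) 0 =
      m ^ 4 + 6 * m ^ 2 * V + 3 * V ^ 2 := by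
  have hE (t : ℝ) : HasDerivAt (fun t => Real.exp (m * t + V * t ^ 2 / 2))
      (Real.exp (m * t + V * t ^ 2 / 2) * (m + V * t)) t := by
    have : HasDerivAt (fun t => m * t + V * t ^ 2 / 2) (m + V * t) t := by
      have h := ((hasDerivAt_id t).const_mul m).add
        ((((hasDerivAt_id t).pow 2).const_mul V).div_const 2)
      refine h.congr_deriv ?_
      simp; ring
    exact this.exp
  have hl (t : ℝ) : HasDerivAt (fun t => m + V * t) V t := by
    simpa using ((hasDerivAt_id t).const_mul V).const_add m
  have d1 : deriv (fun t => Real.exp (m * t + V * t ^ 2 / 2)) =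
      fun t => Real.exp (m * t + V * t ^ 2 / 2) * (m + V * t) :=
    funext fun t => (hE t).deriv
  have d2 : deriv (fun t => Real.exp (m * t + V * t ^ 2 / 2) * (m + V * t)) =
      fun t => Real.exp (m * t + V * t ^ 2 / 2) * ((m + V * t) ^ 2 + V) := by
    funext t
    have := ((hE t).mul (hl t)).deriv
    simp only [Pi.mul_def] at this
    rw [this]; ring
  have d3 : deriv (fun t => Real.exp (m * t + V * t ^ 2 / 2) * ((m + V * t) ^ 2 + V)) =
      fun t => Real.exp (m * t + V * t ^ 2 / 2) * ((m + V * t) ^ 3 + 3 * V * (m + V * t)) := by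
    funext t
    have := ((hE t).mul (((hl t).pow 2).add_const V)).deriv
    simp only [Pi.mul_def, Pi.pow_def] at this
    rw [this]; simp; ring
  have d4 : deriv (fun t => Real.exp (m * t + V * t ^ 2 / 2) *
      ((m + V * t) ^ 3 + 3 * V * (m + V * t))) = fun t => Real.exp (m * t + V * t ^ 2 / 2) *
        ((m + V * t) ^ 4 + 6 * (m + V * t) ^ 2 * V + 3 * V ^ 2) := by
    funext t
    have := ((hE t).mul (((hl t).pow 3).add ((hl t).const_mul (3 * V)))).deriv
    simp only [Pi.mul_def, Pi.pow_def, Pi.add_def] at this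
    rw [this]; simp; ring
  constructor
  · simp only [iteratedDeriv_succ, iteratedDeriv_zero, d1, d2]; simp
  · simp only [iteratedDeriv_succ, iteratedDeriv_zero, d1, d2, d3, d4]; simp

/-- The fourth moment of a real Gaussian in terms of the lower ones. -/
lemma integral_pow_four_gaussianReal (m : ℝ) (V : NNReal) :
    ∫ y, y ^ 4 ∂(gaussianReal m V) =
      3 * (∫ y, y ^ 2 ∂(gaussianReal m V)) ^ 2 - 2 * (∫ y, y ∂(gaussianReal m V)) ^ 4 := by
  have h0 : (0 : ℝ) ∈ interior (integrableExpSet id (gaussianReal m V)) := by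
    simp [integrableExpSet_id_gaussianReal]
  have h2 := iteratedDeriv_mgf_zero h0 2
  have h4 := iteratedDeriv_mgf_zero h0 4
  rw [mgf_id_gaussianReal] at h2 h4
  rw [(iteratedDeriv_gaussian_mgf_four m V).1] at h2
  rw [(iteratedDeriv_gaussian_mgf_four m V).2] at h4
  simp only [Pi.pow_apply, id_eq] at h2 h4
  -- `m⁴ + 6m²V + 3V² = 3(m² + V)² - 2m⁴`, a form free of the variance, so it applies directly to
  -- raw moments.
  rw [← h2, ← h4, integral_id_gaussianReal]
  ring

/-- The projection of `s • unitVec (angle z + w)` is `s cos(w - φ)`, and `s`, `w` are independent.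
-/
lemma integral_posterior_inner_pow (k : ℝ) {τ v : NNReal} (hτ : τ ≠ 0) (hv : v ≠ 0) (z : Plane)
    (φ : ℝ) (n : ℕ) :
    ∫ x, (innerSL ℝ (unitVec (angle z + φ)) x) ^ n ∂(posterior (posteriorDensity k τ v) z) =
      (∫ s, s ^ n ∂(signedRangeLaw τ (k * ‖z‖))) *
        ∫ w, Real.cos (w - φ) ^ n ∂(gaussianReal 0 v) := by
  have := isProbabilityMeasure_signedRangeLaw hτ (k * ‖z‖)
  rw [posterior_posteriorDensity k hτ hv z, integral_map (by fun_prop)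
    (by fun_prop), ← integral_prod_mul]
  refine integral_congr_ae (ae_of_all _ fun p => ?_)
  simp only [map_smul, smul_eq_mul]
  rw [← mul_pow]
  congr 2
  have : p.2 - φ = (angle z + p.2) - (angle z + φ) := by ring
  rw [this, Real.cos_sub]
  simp [PiLp.inner_apply, Fin.sum_univ_two]

lemma integral_pow_four_signedRangeLaw_pos {τ : NNReal} (hτ : τ ≠ 0) (μ : ℝ) :
    0 < ∫ s, s ^ 4 ∂(signedRangeLaw τ μ) := by
  rw [integral_signedRangeLaw hτ]
  refine div_pos ?_ (absMean_pos hτ μ)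
  rw [integral_pos_iff_support_of_nonneg (fun _ => by positivity)
    ((integrable_abs_pow_gaussianReal μ τ 5).congr (ae_of_all _ fun s => ?_))]
  · have h : Function.support (fun y : ℝ => |y| * y ^ 4) = {0}ᶜ := by
      ext y; simp
    have := nullSingletonClass_gaussianReal (μ := μ) hτ
    rw [h, prob_compl_eq_one_sub (measurableSet_singleton _)]
    simp
  · have : (|s| : ℝ) ^ 4 = s ^ 4 := by
      rw [← abs_pow, abs_of_nonneg (by positivity)]
    simp only [← this]
    ring

/-- The posterior is not Gaussian: its projections to the directions at angles `0`, `π / 4` and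
`π / 2` from `z` cannot all have Gaussian moments up to order four. -/
lemma not_isGaussian_posterior (k : ℝ) {τ v : NNReal} (hτ : τ ≠ 0) (hv : v ≠ 0) (z : Plane) :
    ¬ IsGaussian (posterior (posteriorDensity k τ v) z) := by
  intro hG
  have key (φ : ℝ) := by
    let L := innerSL ℝ (unitVec (angle z + φ))
    have hL := hG.map_eq_gaussianReal L
    have h := integral_pow_four_gaussianReal (∫ x, L x ∂(posterior (posteriorDensity k τ v) z))
      (Var[L; posterior (posteriorDensity k τ v) z].toNNReal)
    rw [← hL, integral_map (by fun_prop) (by fun_prop), integral_map (by fun_prop) (by fun_prop),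
      integral_map (by fun_prop) (by fun_prop)] at h
    have h1 := integral_posterior_inner_pow k hτ hv z φ 1
    simp only [pow_one] at h1
    rw [integral_posterior_inner_pow k hτ hv z φ 4, integral_posterior_inner_pow k hτ hv z φ 2,
      h1, integral_cos_sub_gaussianReal, integral_cos_sub_sq_gaussianReal,
      integral_cos_sub_pow_four_gaussianReal] at h
    exact h
  have k0 := key 0
  have k1 := key (Real.pi / 4)
  have k2 := key (Real.pi / 2)
  have e1 : 2 * (Real.pi / 4) = Real.pi / 2 := by ring
  have e2 : 4 * (Real.pi / 4) = Real.pi := by ring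
  have e3 : 2 * (Real.pi / 2) = Real.pi := by ring
  have e4 : 4 * (Real.pi / 2) = 2 * Real.pi := by ring
  have e5 : (√2 / 2) ^ 4 = (1 / 4 : ℝ) := by
    have : (√2 / 2) ^ 4 = ((√2) ^ 2) ^ 2 / 16 := by ring
    rw [this, Real.sq_sqrt (by norm_num)]; norm_num
  have e6 (m a : ℝ) : (m * (a * (√2 / 2))) ^ 4 = m ^ 4 * a ^ 4 / 4 := by
    rw [mul_pow, mul_pow, e5]; ring
  rw [e1, e2, Real.cos_pi_div_two, Real.cos_pi, Real.cos_pi_div_four, e6] at k1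
  rw [e3, e4, Real.cos_pi, Real.cos_two_pi, Real.cos_pi_div_two] at k2
  simp only [mul_zero, Real.cos_zero] at k0
  have hm := integral_pow_four_signedRangeLaw_pos hτ (k * ‖z‖)
  have hv' : (0 : ℝ) < v := by positivity
  have hb0 : 0 < Real.exp (-(2 * v)) := Real.exp_pos _
  have hb1 : Real.exp (-(2 * v)) < 1 := by
    rw [Real.exp_lt_one_iff]; linarith
  generalize Real.exp (-(2 * v)) = b at *
  generalize ∫ s, s ^ 4 ∂(signedRangeLaw τ (k * ‖z‖)) = m4 at *
  generalize ∫ s, s ^ 2 ∂(signedRangeLaw τ (k * ‖z‖)) = m2 at *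
  generalize ∫ s, s ∂(signedRangeLaw τ (k * ‖z‖)) = m1 at *
  -- Directions `0` and `π / 4` are combined so that `m1 ^ 4` cancels; at `π / 2` the mean vanishes
  -- by itself.
  have f1 : (1 - b) * (m4 * (5 * b ^ 3 + 5 * b ^ 2 + 5 * b + 9) - 6 * m2 ^ 2 * (b + 3)) = 0 := by
    linear_combination (-8) * k0 + 32 * k1
  have f2 : (1 - b) ^ 2 * (m4 * (b ^ 2 + 2 * b + 3) - 6 * m2 ^ 2) = 0 := by
    linear_combination 8 * k2
  have hb : 1 - b ≠ 0 := by linarith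
  have f1' := (mul_eq_zero.1 f1).resolve_left hb
  have f2' := (mul_eq_zero.1 f2).resolve_left (pow_ne_zero 2 hb)
  -- Eliminating `m2 ^ 2` leaves a product of nonzero factors, since `m4 > 0` and `0 < b < 1`.
  have f3 : m4 * (4 * b * (1 - b) * (1 + b)) = 0 := by
    linear_combination (b + 3) * f2' - f1'
  have : 0 < m4 * (4 * b * (1 - b) * (1 + b)) := by
    have : 0 < 1 - b := by linarith
    positivity
  linarith

/-! ### The signed second moment for small and large means. -/

/-- The signed second moment `E |Y| Y` of `Y ∼ N(μ, τ)`. -/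
noncomputable def signedSqMean (τ : NNReal) (μ : ℝ) : ℝ := ∫ y, |y| * y ∂(gaussianReal μ τ)

lemma integrable_abs_mul_self_gaussianReal (μ : ℝ) (τ : NNReal) :
    Integrable (fun y => |y| * y) (gaussianReal μ τ) :=
  (integrable_abs_pow_gaussianReal μ τ 2).mono' (by fun_prop)
    (ae_of_all _ fun y => by simp [pow_two])

lemma integrable_abs_mul_self_add (μ : ℝ) (τ : NNReal) :
    Integrable (fun y => |μ + y| * (μ + y)) (gaussianReal 0 τ) :=
  integrable_add_gaussianReal μ τ (f := fun y => |y| * y) (by fun_prop)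
    (integrable_abs_mul_self_gaussianReal μ τ)

lemma integrable_abs_add (μ : ℝ) (τ : NNReal) :
    Integrable (fun y => |μ + y|) (gaussianReal 0 τ) :=
  integrable_add_gaussianReal μ τ continuous_abs (integrable_abs_gaussianReal μ τ)

lemma signedSqMean_eq (τ : NNReal) (μ : ℝ) :
    signedSqMean τ μ = ∫ y, |μ + y| * (μ + y) ∂(gaussianReal 0 τ) :=
  integral_gaussianReal_eq_integral_add μ τ (f := fun y => |y| * y) (by fun_prop)

lemma absMean_eq (τ : NNReal) (μ : ℝ) :
    absMean τ μ = ∫ y, |μ + y| ∂(gaussianReal 0 τ) :=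
  integral_gaussianReal_eq_integral_add μ τ continuous_abs

lemma abs_signedSqMean_sub_le (τ : NNReal) (μ ν : ℝ) :
    |signedSqMean τ μ - signedSqMean τ ν| ≤ |μ - ν| * (absMean τ μ + absMean τ ν) := by
  rw [signedSqMean_eq, signedSqMean_eq, absMean_eq, absMean_eq,
    ← integral_sub (integrable_abs_mul_self_add μ τ) (integrable_abs_mul_self_add ν τ),
    ← integral_add (integrable_abs_add μ τ) (integrable_abs_add ν τ), ← integral_const_mul]
  refine abs_integral_le_integral_abs.trans ?_
  refine integral_mono_of_nonneg (ae_of_all _ fun _ => abs_nonneg _)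
    (((integrable_abs_add μ τ).add (integrable_abs_add ν τ)).const_mul _) (ae_of_all _ fun y => ?_)
  have h : μ - ν = (μ + y) - (ν + y) := by ring
  simp only [h]
  generalize μ + y = a
  generalize ν + y = b
  rcases abs_cases a with ⟨ha, _⟩ | ⟨ha, _⟩ <;> rcases abs_cases b with ⟨hb, _⟩ | ⟨hb, _⟩ <;>
    rcases abs_cases (a - b) with ⟨hab, _⟩ | ⟨hab, _⟩ <;> rw [ha, hb, hab, abs_le] <;>
    constructor <;> nlinarith

lemma continuous_signedSqMean (τ : NNReal) : Continuous (signedSqMean τ) := by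
  rw [continuous_iff_continuousAt]
  intro ν
  have hc : Continuous fun μ => |μ - ν| * (absMean τ μ + absMean τ ν) := by fun_prop
  have h0 : Tendsto (fun μ => |μ - ν| * (absMean τ μ + absMean τ ν)) (𝓝 ν) (𝓝 0) := by
    simpa using hc.tendsto ν
  exact tendsto_iff_dist_tendsto_zero.2 (squeeze_zero (fun _ => dist_nonneg)
    (fun μ => abs_signedSqMean_sub_le τ μ ν) h0)

lemma signedSqMean_zero (τ : NNReal) : signedSqMean τ 0 = 0 := by
  have h := gaussianReal_map_neg (μ := 0) (v := τ)
  rw [neg_zero] at h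
  have h2 : signedSqMean τ 0 = -signedSqMean τ 0 := by
    conv_lhs => rw [signedSqMean, ← h, integral_map (by fun_prop) (by fun_prop)]
    rw [signedSqMean, ← integral_neg]
    simp
  linarith

/-- First-order expansion at `μ = 0`: the derivative `2|y|` of `|y| y` is 2-Lipschitz, so the
pointwise remainder is at most `μ²`. The coefficient `2` is the origin of the factor 2 between the
two limits. -/
lemma abs_signedSqMean_sub_two_mul_le (τ : NNReal) (μ : ℝ) :
    |signedSqMean τ μ - 2 * μ * absMean τ 0| ≤ μ ^ 2 := by
  have i1 := integrable_abs_mul_self_add μ τ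
  have i2 := integrable_abs_mul_self_gaussianReal 0 τ
  have i3 := (integrable_abs_gaussianReal 0 τ).const_mul (2 * μ)
  have h : signedSqMean τ μ - 2 * μ * absMean τ 0 =
      ∫ y, (|μ + y| * (μ + y) - |y| * y - 2 * μ * |y|) ∂(gaussianReal 0 τ) := by
    have i12 : Integrable (fun y => |μ + y| * (μ + y) - |y| * y) (gaussianReal 0 τ) := i1.sub i2
    rw [integral_sub i12 i3, integral_sub i1 i2, integral_const_mul, ← signedSqMean_eq]
    change _ = signedSqMean τ μ - signedSqMean τ 0 - 2 * μ * absMean τ 0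
    rw [signedSqMean_zero]; ring
  rw [h]
  refine abs_integral_le_integral_abs.trans ?_
  refine (integral_mono_of_nonneg (ae_of_all _ fun _ => abs_nonneg _)
    (integrable_const (μ ^ 2)) (ae_of_all _ fun y => ?_)).trans (by simp)
  simp only
  rcases abs_cases (μ + y) with ⟨ha, _⟩ | ⟨ha, _⟩ <;> rcases abs_cases y with ⟨hb, _⟩ | ⟨hb, _⟩ <;>
    rw [ha, hb, abs_le] <;> constructor <;> nlinarith [sq_nonneg (μ + y)]

/-- The difference is the mean of `|μ + y| y`, hence of linear growth in `μ`, while `μ * absMean τ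
μ` is at least `μ²` for `μ > 0`. -/
lemma abs_signedSqMean_sub_mul_absMean_le (τ : NNReal) (μ : ℝ) :
    |signedSqMean τ μ - μ * absMean τ μ| ≤
      |μ| * absMean τ 0 + ∫ y, |y| ^ 2 ∂(gaussianReal 0 τ) := by
  have i1 := integrable_abs_mul_self_add μ τ
  have i2 := (integrable_abs_add μ τ).const_mul μ
  have i3 := (integrable_abs_gaussianReal 0 τ).const_mul |μ|
  have i4 := integrable_abs_pow_gaussianReal 0 τ 2
  rw [signedSqMean_eq, absMean_eq, ← integral_const_mul, ← integral_sub i1 i2, absMean,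
    ← integral_const_mul, ← integral_add i3 i4]
  refine abs_integral_le_integral_abs.trans ?_
  refine integral_mono_of_nonneg (ae_of_all _ fun _ => abs_nonneg _) (i3.add i4)
    (ae_of_all _ fun y => ?_)
  have h : |μ + y| * (μ + y) - μ * |μ + y| = |μ + y| * y := by ring
  simp only [h, abs_mul, abs_abs]
  have := abs_add_le μ y
  nlinarith [abs_nonneg y]

lemma abs_le_absMean (τ : NNReal) (μ : ℝ) : |μ| ≤ absMean τ μ := by
  conv_lhs => rw [← integral_id_gaussianReal (μ := μ) (v := τ)]
  exact abs_integral_le_integral_abs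

lemma tendsto_signedSqMean_div_zero {τ : NNReal} (hτ : τ ≠ 0) :
    Tendsto (fun μ => signedSqMean τ μ / (μ * absMean τ μ)) (𝓝[>] 0) (𝓝 2) := by
  have hA := absMean_pos hτ 0
  have h1 : Tendsto (fun μ => signedSqMean τ μ / μ) (𝓝[>] 0) (𝓝 (2 * absMean τ 0)) := by
    rw [tendsto_iff_dist_tendsto_zero]
    refine squeeze_zero' (Eventually.of_forall fun _ => dist_nonneg) (g := fun μ => μ) ?_
      (tendsto_nhdsWithin_of_tendsto_nhds tendsto_id)
    filter_upwards [self_mem_nhdsWithin] with μ hμ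
    have hμ : 0 < μ := hμ
    have h := abs_signedSqMean_sub_two_mul_le τ μ
    have e : signedSqMean τ μ / μ - 2 * absMean τ 0 =
        (signedSqMean τ μ - 2 * μ * absMean τ 0) / μ := by
      field_simp
    rw [Real.dist_eq, e, abs_div, abs_of_pos hμ, div_le_iff₀ hμ]
    linarith
  have h2 : Tendsto (absMean τ) (𝓝[>] 0) (𝓝 (absMean τ 0)) :=
    tendsto_nhdsWithin_of_tendsto_nhds ((continuous_absMean τ).tendsto 0)
  have h3 := h1.div h2 hA.ne'
  rw [mul_div_assoc, div_self hA.ne', mul_one] at h3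
  exact h3.congr fun μ => by simp [div_div]

lemma tendsto_signedSqMean_div_atTop {τ : NNReal} (hτ : τ ≠ 0) :
    Tendsto (fun μ => signedSqMean τ μ / (μ * absMean τ μ)) atTop (𝓝 1) := by
  rw [tendsto_iff_dist_tendsto_zero]
  set C := ∫ y, |y| ^ 2 ∂(gaussianReal 0 τ) with hC
  have hC0 : 0 ≤ C := integral_nonneg fun _ => by positivity
  have hb : Tendsto (fun μ : ℝ => absMean τ 0 * μ⁻¹ + C * (μ⁻¹ * μ⁻¹)) atTop (𝓝 0) := by
    have h := (tendsto_inv_atTop_zero (𝕜 := ℝ))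
    simpa using (h.const_mul (absMean τ 0)).add ((h.mul h).const_mul C)
  refine squeeze_zero' (Eventually.of_forall fun _ => dist_nonneg) ?_ hb
  filter_upwards [eventually_gt_atTop 0] with μ hμ
  have hA := absMean_pos hτ μ
  have hA0 := absMean_nonneg τ 0
  have h := abs_signedSqMean_sub_mul_absMean_le τ μ
  have hle := abs_le_absMean τ μ
  rw [abs_of_pos hμ] at h hle
  have e : signedSqMean τ μ / (μ * absMean τ μ) - 1 =
      (signedSqMean τ μ - μ * absMean τ μ) / (μ * absMean τ μ) := by
    field_simp
  rw [Real.dist_eq, e, abs_div, abs_of_pos (mul_pos hμ hA)]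
  calc _ ≤ (μ * absMean τ 0 + C) / (μ * μ) := by gcongr
    _ = _ := by field_simp

/-! ### The Bayes estimator: radial form, limits, and failure of affinity. -/

/-- The factor `q` with `g*(R u_β) = q(R) u_β`. -/
noncomputable def radialEstimate (k : ℝ) (τ v : NNReal) (R : ℝ) : ℝ :=
  Real.exp (-(v / 2)) * (signedSqMean τ (k * R) / absMean τ (k * R))

lemma continuous_radialEstimate (k : ℝ) {τ : NNReal} (hτ : τ ≠ 0) (v : NNReal) :
    Continuous (radialEstimate k τ v) := by
  have h1 := continuous_signedSqMean τ
  unfold radialEstimate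
  refine Continuous.mul continuous_const (Continuous.div (by fun_prop) (by fun_prop) ?_)
  exact fun R => (absMean_pos hτ _).ne'

lemma radialEstimate_div (k : ℝ) (hk : 0 < k) (τ v : NNReal) (R : ℝ) :
    radialEstimate k τ v R / R = Real.exp (-(v / 2)) * k *
      (signedSqMean τ (k * R) / ((k * R) * absMean τ (k * R))) := by
  rw [radialEstimate]
  -- At `R = 0` both sides are divisions by zero, with value `0`.
  rcases eq_or_ne R 0 with rfl | hR
  · simp
  · field_simp

lemma tendsto_radialEstimate_div_zero {k : ℝ} (hk : 0 < k) {τ : NNReal} (hτ : τ ≠ 0)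
    (v : NNReal) : Tendsto (fun R => radialEstimate k τ v R / R) (𝓝[>] 0)
      (𝓝 (2 * (Real.exp (-(v / 2)) * k))) := by
  simp only [radialEstimate_div k hk]
  have h : Tendsto (fun R => k * R) (𝓝[>] 0) (𝓝[>] 0) := by
    refine tendsto_nhdsWithin_iff.2 ⟨?_, ?_⟩
    · refine tendsto_nhdsWithin_of_tendsto_nhds ?_
      simpa using (continuous_const_mul k).tendsto 0
    · filter_upwards [self_mem_nhdsWithin] with R hR
      exact mul_pos hk hR
  have := ((tendsto_signedSqMean_div_zero hτ).comp h).const_mul (Real.exp (-(v / 2)) * k)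
  rw [mul_comm 2]
  exact this

lemma tendsto_radialEstimate_div_atTop {k : ℝ} (hk : 0 < k) {τ : NNReal} (hτ : τ ≠ 0)
    (v : NNReal) : Tendsto (fun R => radialEstimate k τ v R / R) atTop
      (𝓝 (Real.exp (-(v / 2)) * k)) := by
  simp only [radialEstimate_div k hk]
  have := ((tendsto_signedSqMean_div_atTop hτ).comp
    (tendsto_id.const_mul_atTop hk)).const_mul (Real.exp (-(v / 2)) * k)
  rw [mul_one] at this
  exact this

lemma integrable_id_posterior (k : ℝ) {τ v : NNReal} (hτ : τ ≠ 0) (hv : v ≠ 0) (z : Plane) :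
    Integrable (fun x => x) (posterior (posteriorDensity k τ v) z) := by
  have := isProbabilityMeasure_signedRangeLaw hτ (k * ‖z‖)
  rw [posterior_posteriorDensity k hτ hv z, integrable_map_measure (by fun_prop) (by fun_prop)]
  have h := (integrable_pow_signedRangeLaw hτ (k * ‖z‖) 1).comp_fst (gaussianReal 0 v)
  refine h.mono (by fun_prop) (ae_of_all _ fun p => ?_)
  simp [norm_smul, norm_unitVec]

lemma integrable_posteriorDensity_smul (k : ℝ) {τ v : NNReal} (hτ : τ ≠ 0) (hv : v ≠ 0)
    (z : Plane) : Integrable (fun x : Plane => posteriorDensity k τ v z x • x) := by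
  have hp := measurable_posteriorDensity_right k τ hv z
  have h := integrable_id_posterior k hτ hv z
  rw [posterior, integrable_withDensity_iff_integrable_smul' (by fun_prop)
    (ae_of_all _ fun _ => by simp)] at h
  refine h.congr (ae_of_all _ fun x => ?_)
  simp only
  rw [ENNReal.toReal_ofReal (posteriorDensity_nonneg k τ v z x)]

lemma bayesEstimator_eq_integral_posterior (k : ℝ) (τ : NNReal) {v : NNReal} (hv : v ≠ 0)
    (z : Plane) : bayesEstimator (posteriorDensity k τ v) z =
      ∫ x, x ∂(posterior (posteriorDensity k τ v) z) := by
  have hp := measurable_posteriorDensity_right k τ hv z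
  rw [posterior, integral_withDensity_eq_integral_toReal_smul (by fun_prop)
    (ae_of_all _ fun _ => by simp), bayesEstimator]
  refine integral_congr_ae (ae_of_all _ fun x => ?_)
  simp only
  rw [ENNReal.toReal_ofReal (posteriorDensity_nonneg k τ v z x)]

lemma bayesEstimator_posteriorDensity (k : ℝ) {τ v : NNReal} (hτ : τ ≠ 0) (hv : v ≠ 0)
    (z : Plane) : bayesEstimator (posteriorDensity k τ v) z =
      radialEstimate k τ v ‖z‖ • unitVec (angle z) := by
  have := isProbabilityMeasure_signedRangeLaw hτ (k * ‖z‖)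
  have hi := integrable_id_posterior k hτ hv z
  rw [bayesEstimator_eq_integral_posterior k τ hv]
  have key (c : ℝ) : ∫ x, innerSL ℝ (unitVec (angle z + c))
      x ∂(posterior (posteriorDensity k τ v) z) = radialEstimate k τ v ‖z‖ * Real.cos c := by
    have h := integral_posterior_inner_pow k hτ hv z c 1
    simp only [pow_one] at h
    rw [h, integral_cos_sub_gaussianReal, integral_signedRangeLaw hτ, radialEstimate, signedSqMean]
    ring
  have key2 (c : ℝ) : inner ℝ (unitVec (angle z + c))
      (∫ x, x ∂(posterior (posteriorDensity k τ v) z)) =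
      radialEstimate k τ v ‖z‖ * Real.cos c := by
    rw [← key c, ContinuousLinearMap.integral_comp_comm _ hi]; rfl
  -- These two offsets turn the test direction into the coordinate axes.
  have a0 := key2 (-angle z)
  have a1 := key2 (-angle z + Real.pi / 2)
  rw [← add_assoc, Real.cos_add_pi_div_two] at a1
  simp [PiLp.inner_apply, Fin.sum_univ_two] at a0 a1
  ext i
  fin_cases i
  · simpa using a0
  · simpa using a1

lemma smul_unitVec_eq_unitVec_angle {R : ℝ} (hR : 0 < R) (β : ℝ) :
    unitVec (angle (R • unitVec β)) = unitVec β := by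
  have h := norm_smul_unitVec_angle (R • unitVec β)
  rw [norm_smul_unitVec hR] at h
  exact smul_right_injective _ hR.ne' h

lemma bayesEstimator_smul_unitVec (k : ℝ) {τ v : NNReal} (hτ : τ ≠ 0) (hv : v ≠ 0)
    {R : ℝ} (hR : 0 < R) (β : ℝ) : bayesEstimator (posteriorDensity k τ v) (R • unitVec β) =
      radialEstimate k τ v R • unitVec β := by
  rw [bayesEstimator_posteriorDensity k hτ hv, smul_unitVec_eq_unitVec_angle hR,
    norm_smul_unitVec hR]

lemma bayesEstimator_eq_smul (k : ℝ) {τ v : NNReal} (hτ : τ ≠ 0) (hv : v ≠ 0)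
    {z : Plane} (hz : z ≠ 0) : bayesEstimator (posteriorDensity k τ v) z =
      (radialEstimate k τ v ‖z‖ / ‖z‖) • z := by
  have hz' : ‖z‖ ≠ 0 := norm_ne_zero_iff.2 hz
  rw [bayesEstimator_posteriorDensity k hτ hv]
  conv_rhs => rw [← norm_smul_unitVec_angle z, smul_smul]
  rw [norm_smul_unitVec_angle, div_mul_cancel₀ _ hz']

lemma continuousOn_bayesEstimator (k : ℝ) {τ v : NNReal} (hτ : τ ≠ 0) (hv : v ≠ 0) :
    ContinuousOn (bayesEstimator (posteriorDensity k τ v)) {0}ᶜ := by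
  have hq := continuous_radialEstimate k hτ v
  have h : ContinuousOn (fun z : Plane => (radialEstimate k τ v ‖z‖ / ‖z‖) • z) {0}ᶜ := by
    exact ContinuousOn.smul (ContinuousOn.div (hq.comp continuous_norm).continuousOn
      continuous_norm.continuousOn fun z hz => norm_ne_zero_iff.2 hz) continuousOn_id
  exact h.congr fun z hz => bayesEstimator_eq_smul k hτ hv hz

/-- By continuity, equality almost everywhere is equality off the origin. Subtracting the values at
the antipodal points `R • unitVec 0` and `R • unitVec π` removes `a`, so `q(R) / R` would be the
constant `B 0 0`, against its two different limits. -/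
lemma not_ae_eq_affineEstimator {k : ℝ} (hk : 0 < k) {τ v : NNReal} (hτ : τ ≠ 0) (hv : v ≠ 0)
    (a : Plane) (B : Matrix (Fin 2) (Fin 2) ℝ) :
    ¬ bayesEstimator (posteriorDensity k τ v) =ᵐ[volume] affineEstimator a B := by
  intro h
  have hB : Continuous (affineEstimator a B) := by
    unfold affineEstimator
    exact continuous_const.add (LinearMap.continuous_of_finiteDimensional _)
  have heq : Set.EqOn (bayesEstimator (posteriorDensity k τ v)) (affineEstimator a B) {0}ᶜ :=
    Measure.eqOn_open_of_ae_eq (ae_restrict_of_ae h) isOpen_compl_singleton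
      (continuousOn_bayesEstimator k hτ hv) hB.continuousOn
  have key (R : ℝ) (hR : 0 < R) : radialEstimate k τ v R / R = B 0 0 := by
    have h1 := heq (x := R • unitVec 0) (by
      have := norm_smul_unitVec hR 0
      intro h0
      rw [Set.mem_singleton_iff.1 h0] at this
      simp at this; linarith)
    have h2 := heq (x := R • unitVec Real.pi) (by
      have := norm_smul_unitVec hR Real.pi
      intro h0
      rw [Set.mem_singleton_iff.1 h0] at this
      simp at this; linarith)
    rw [bayesEstimator_smul_unitVec k hτ hv hR] at h1 h2
    have e1 := congrArg (fun x : Plane => x 0) h1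
    have e2 := congrArg (fun x : Plane => x 0) h2
    simp [affineEstimator, Matrix.toLpLin_apply] at e1 e2
    rw [div_eq_iff hR.ne']
    linarith
  have l0 : Tendsto (fun R => radialEstimate k τ v R / R) (𝓝[>] 0) (𝓝 (B 0 0)) :=
    tendsto_const_nhds.congr' (by
      filter_upwards [self_mem_nhdsWithin] with R hR using (key R hR).symm)
  have l1 : Tendsto (fun R => radialEstimate k τ v R / R) atTop (𝓝 (B 0 0)) :=
    tendsto_const_nhds.congr' (by
      filter_upwards [eventually_gt_atTop 0] with R hR using (key R hR).symm)
  have e0 := tendsto_nhds_unique l0 (tendsto_radialEstimate_div_zero hk hτ v)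
  have e1 := tendsto_nhds_unique l1 (tendsto_radialEstimate_div_atTop hk hτ v)
  have : 0 < Real.exp (-(v / 2)) * k := by positivity
  linarith

/-! ### The Gaussian prior and Bayes' formula. -/

/-- The density of the law `N(0, σ² I)` in the plane. -/
noncomputable def planeGaussianPDF (σ ρ : ℝ) : ℝ :=
  (2 * Real.pi * σ ^ 2)⁻¹ * Real.exp (-ρ ^ 2 / (2 * σ ^ 2))

/-- Both sides are finite measures with the same characteristic function, by the Gaussian Fourier
integral. -/
lemma multivariateGaussian_eq_withDensity {σ : ℝ} (hσ : 0 < σ) :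
    multivariateGaussian 0 (σ ^ 2 • (1 : Matrix (Fin 2) (Fin 2) ℝ)) =
      (volume : Measure Plane).withDensity fun x => ENNReal.ofReal (planeGaussianPDF σ ‖x‖) := by
  have hb : 0 < ((1 / (2 * σ ^ 2) : ℝ) : ℂ).re := by
    rw [Complex.ofReal_re]; positivity
  have hm : Measurable fun x : Plane => planeGaussianPDF σ ‖x‖ := by
    unfold planeGaussianPDF; fun_prop
  have hpos (x : Plane) : 0 ≤ planeGaussianPDF σ ‖x‖ := by
    unfold planeGaussianPDF; positivity
  have hcexp (t x : Plane) :
      Complex.exp (inner ℝ x t * Complex.I) * (planeGaussianPDF σ ‖x‖ : ℂ) =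
      (2 * Real.pi * σ ^ 2 : ℂ)⁻¹ * Complex.exp (-((1 / (2 * σ ^ 2) : ℝ) : ℂ) * ‖x‖ ^ 2 +
        Complex.I * inner ℝ t x) := by
    rw [planeGaussianPDF, real_inner_comm, Complex.exp_add]
    push_cast
    rw [mul_comm Complex.I]
    have : (-(‖x‖ : ℂ) ^ 2 / (2 * σ ^ 2)) = -(1 / (2 * σ ^ 2)) * ‖x‖ ^ 2 := by ring
    rw [this]
    ring
  have hint : Integrable fun x : Plane => planeGaussianPDF σ ‖x‖ := by
    have h := (GaussianFourier.integrable_cexp_neg_mul_sq_norm_add hb Complex.I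
      (0 : Plane)).const_mul (2 * Real.pi * σ ^ 2 : ℂ)⁻¹
    simp only [← hcexp] at h
    simpa using h.re
  have := isFiniteMeasure_withDensity_ofReal hint.2
  refine Measure.ext_of_charFun ?_
  ext t
  have hS : (σ ^ 2 • (1 : Matrix (Fin 2) (Fin 2) ℝ)).PosSemidef :=
    Matrix.PosSemidef.one.smul (by positivity)
  rw [charFun_multivariateGaussian hS, charFun_apply,
    integral_withDensity_eq_integral_toReal_smul (by fun_prop) (ae_of_all _ fun _ => by simp)]
  have e (x : Plane) : (ENNReal.ofReal (planeGaussianPDF σ ‖x‖)).toReal •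
      Complex.exp (inner ℝ x t * Complex.I) =
      (2 * Real.pi * σ ^ 2 : ℂ)⁻¹ * Complex.exp (-((1 / (2 * σ ^ 2) : ℝ) : ℂ) * ‖x‖ ^ 2 +
        Complex.I * inner ℝ t x) := by
    rw [← hcexp, ENNReal.toReal_ofReal (hpos x), Complex.real_smul, mul_comm]
  simp only [e]
  rw [integral_const_mul, GaussianFourier.integral_cexp_neg_mul_sq_norm_add hb]
  have hσ' : (σ : ℂ) ≠ 0 := by exact_mod_cast hσ.ne'
  have hπ : (Real.pi : ℂ) ≠ 0 := by exact_mod_cast Real.pi_ne_zero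
  have hn : ‖t‖ ^ 2 = t 0 ^ 2 + t 1 ^ 2 := by
    rw [EuclideanSpace.real_norm_sq_eq, Fin.sum_univ_two]
  have hn' : (‖t‖ : ℂ) ^ 2 = (t 0 : ℂ) ^ 2 + (t 1 : ℂ) ^ 2 := by exact_mod_cast hn
  have hd : t.ofLp ⬝ᵥ (σ ^ 2 • (1 : Matrix (Fin 2) (Fin 2) ℝ)).mulVec t.ofLp =
      σ ^ 2 * (t 0 ^ 2 + t 1 ^ 2) := by
    simp [Matrix.smul_mulVec, Matrix.one_mulVec, dotProduct, Fin.sum_univ_two]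
    ring
  rw [hd, hn', finrank_euclideanSpace_fin]
  simp only [inner_zero_right, Complex.I_sq]
  push_cast
  have h2 : ((2 : ℂ) / 2) = 1 := by norm_num
  rw [h2, Complex.cpow_one, ← mul_assoc]
  have h3 : (2 * (Real.pi : ℂ) * (σ : ℂ) ^ 2)⁻¹ *
      ((Real.pi : ℂ) / (1 / (2 * (σ : ℂ) ^ 2))) = 1 := by
    field_simp
  rw [h3, one_mul]
  congr 1
  field_simp
  ring

/-- The factor of `z` in the posterior mean range: the gain of the scalar range problem. -/
noncomputable def gain (σ : ℝ) (vr : NNReal) : ℝ := σ ^ 2 / (σ ^ 2 + vr)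

/-- The posterior variance of the scalar range problem. -/
noncomputable def rangeVar (σ : ℝ) (vr : NNReal) : NNReal :=
  ⟨σ ^ 2 * vr / (σ ^ 2 + vr), by positivity⟩

lemma gain_pos {σ : ℝ} (hσ : 0 < σ) (vr : NNReal) : 0 < gain σ vr := by
  unfold gain; positivity

lemma rangeVar_ne_zero {σ : ℝ} (hσ : 0 < σ) {vr : NNReal} (hvr : vr ≠ 0) :
    rangeVar σ vr ≠ 0 := by
  have hvr' : (0 : ℝ) < vr := by positivity
  have : (0 : ℝ) < rangeVar σ vr := by
    change 0 < σ ^ 2 * vr / (σ ^ 2 + vr)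
    positivity
  exact fun h => by simp [h] at this

/-- The factor independent of the position obtained by completing the square. -/
noncomputable def evidence (σ : ℝ) (vr : NNReal) (r : ℝ) : ℝ :=
  (2 * Real.pi * σ ^ 2)⁻¹ * (√(2 * Real.pi * vr))⁻¹ * √(2 * Real.pi * rangeVar σ vr) *
    Real.exp (-r ^ 2 / (2 * (σ ^ 2 + vr)))

lemma evidence_pos {σ : ℝ} (hσ : 0 < σ) {vr : NNReal} (hvr : vr ≠ 0) (r : ℝ) :
    0 < evidence σ vr r := by
  have hvr' : (0 : ℝ) < vr := by positivity
  have hτ : (0 : ℝ) < rangeVar σ vr := by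
    have := rangeVar_ne_zero hσ hvr
    positivity
  unfold evidence
  positivity

/-- Completing the square in `ρ`. The range `ρ` may be negative, as the reflected branch requires.
-/
lemma planeGaussianPDF_mul_gaussianPDFReal {σ : ℝ} (hσ : 0 < σ) {vr : NNReal} (hvr : vr ≠ 0)
    (r ρ : ℝ) : planeGaussianPDF σ ρ * gaussianPDFReal 0 vr (r - ρ) =
      evidence σ vr r * gaussianPDFReal (gain σ vr * r) (rangeVar σ vr) ρ := by
  have hvr' : (0 : ℝ) < vr := by positivity
  have hτ : (0 : ℝ) < rangeVar σ vr := by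
    have := rangeVar_ne_zero hσ hvr
    positivity
  have h0 : √(2 * Real.pi * rangeVar σ vr) ≠ 0 := by positivity
  rw [planeGaussianPDF, evidence, gaussianPDFReal, gaussianPDFReal]
  have he : Real.exp (-ρ ^ 2 / (2 * σ ^ 2)) * Real.exp (-(r - ρ - 0) ^ 2 / (2 * vr)) =
      Real.exp (-r ^ 2 / (2 * (σ ^ 2 + vr))) *
        Real.exp (-(ρ - gain σ vr * r) ^ 2 / (2 * rangeVar σ vr)) := by
    rw [← Real.exp_add, ← Real.exp_add]
    congr 1
    have : (rangeVar σ vr : ℝ) = σ ^ 2 * vr / (σ ^ 2 + vr) := rfl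
    rw [this, gain]
    field_simp
    ring
  calc _ = (2 * Real.pi * σ ^ 2)⁻¹ * (√(2 * Real.pi * vr))⁻¹ *
      (Real.exp (-ρ ^ 2 / (2 * σ ^ 2)) * Real.exp (-(r - ρ - 0) ^ 2 / (2 * vr))) := by ring
    _ = _ := by rw [he]; field_simp

/-- The density of the law of the measurement. -/
noncomputable def measurementPDF (σ : ℝ) (vr : NNReal) (z : Plane) : ℝ :=
  evidence σ vr ‖z‖ * absMean (rangeVar σ vr) (gain σ vr * ‖z‖) / ‖z‖

lemma measurementPDF_pos {σ : ℝ} (hσ : 0 < σ) {vr : NNReal} (hvr : vr ≠ 0) {z : Plane}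
    (hz : z ≠ 0) : 0 < measurementPDF σ vr z := by
  have h1 := evidence_pos hσ hvr ‖z‖
  have h2 := absMean_pos (rangeVar_ne_zero hσ hvr) (gain σ vr * ‖z‖)
  have h3 : 0 < ‖z‖ := norm_pos_iff.2 hz
  unfold measurementPDF
  positivity

lemma measurable_measurementPDF (σ : ℝ) (vr : NNReal) : Measurable (measurementPDF σ vr) := by
  have hA := (continuous_absMean (rangeVar σ vr)).measurable
  unfold measurementPDF evidence
  fun_prop

/-- The posterior density for prior variance `σ²`, range noise variance `vr` and bearing noise
variance `v`. -/
noncomputable abbrev lidarPosterior (σ : ℝ) (vr v : NNReal) : Plane → Plane → ℝ :=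
  posteriorDensity (gain σ vr) (rangeVar σ vr) v

lemma bayes_formula {σ : ℝ} (hσ : 0 < σ) {vr v : NNReal} (hvr : vr ≠ 0) {z : Plane}
    (hz : z ≠ 0) (x : Plane) :
    planeGaussianPDF σ ‖x‖ * ((gaussianPDFReal 0 vr (‖z‖ - ‖x‖) *
        wrappedPDF v (angle z - angle x) + gaussianPDFReal 0 vr (-‖z‖ - ‖x‖) *
        wrappedPDF v (angle z - angle x + Real.pi)) / ‖z‖) =
      measurementPDF σ vr z * lidarPosterior σ vr v z x := by
  have h2 := (absMean_pos (rangeVar_ne_zero hσ hvr) (gain σ vr * ‖z‖)).ne'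
  have e1 := planeGaussianPDF_mul_gaussianPDFReal hσ hvr ‖z‖ ‖x‖
  have e2 := planeGaussianPDF_mul_gaussianPDFReal hσ hvr ‖z‖ (-‖x‖)
  have e3 : planeGaussianPDF σ (-‖x‖) = planeGaussianPDF σ ‖x‖ := by simp [planeGaussianPDF]
  -- The branch with measured range `-‖z‖` and true range `‖x‖` equals the one with `‖z‖` and
  -- `-‖x‖`, so both branches share the same evidence factor.
  have e4 : gaussianPDFReal 0 vr (‖z‖ - -‖x‖) = gaussianPDFReal 0 vr (-‖z‖ - ‖x‖) := by
    simp only [gaussianPDFReal]; ring_nf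
  have e5 : wrappedPDF v (angle z - angle x) = wrappedPDF v (angle x - angle z) := by
    rw [← wrappedPDF_neg]; ring_nf
  have e6 : wrappedPDF v (angle z - angle x + Real.pi) =
      wrappedPDF v (angle x - angle z + Real.pi) := by
    rw [← wrappedPDF_neg, ← wrappedPDF_periodic v]; ring_nf
  rw [e3, e4] at e2
  rw [e5, e6, measurementPDF, lidarPosterior, posteriorDensity]
  have h3 : ‖z‖ ≠ 0 := norm_ne_zero_iff.2 hz
  generalize gain σ vr * ‖z‖ = t at *
  field_simp
  linear_combination wrappedPDF v (angle x - angle z) * e1 +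
    wrappedPDF v (angle x - angle z + Real.pi) * e2

/-! ### The joint law of measurement and position, and the conditional distribution. -/

lemma ae_ne_zero : ∀ᵐ z : Plane, z ≠ 0 := by
  simp [ae_iff]

@[fun_prop]
lemma measurable_measurement : Measurable fun q : Plane × ℝ × ℝ =>
    measurement q.1 q.2.1 q.2.2 := by
  simp only [measurement_eq]
  fun_prop

/-- Tonelli exchanges the two integrals once the law of the measurement given `x` has a density;
`bayes_formula` then refactors the joint density as evidence times posterior. -/
lemma lintegral_measurement {σ : ℝ} (hσ : 0 < σ) {vr v : NNReal} (hvr : vr ≠ 0) (hv : v ≠ 0)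
    {F : Plane × Plane → ENNReal} (hF : Measurable F) :
    ∫⁻ x, ∫⁻ r, ∫⁻ w, F (measurement x r w, x) ∂(gaussianReal 0 v) ∂(gaussianReal 0 vr)
      ∂(multivariateGaussian 0 (σ ^ 2 • (1 : Matrix (Fin 2) (Fin 2) ℝ))) =
    ∫⁻ z, ENNReal.ofReal (measurementPDF σ vr z) *
      ∫⁻ x, ENNReal.ofReal (lidarPosterior σ vr v z x) * F (z, x) := by
  have hp : Measurable fun zx : Plane × Plane => lidarPosterior σ vr v zx.1 zx.2 :=
    measurable_posteriorDensity _ _ hv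
  have hmz := measurable_measurementPDF σ vr
  have hg := measurable_gaussianPDF 0 vr
  have hpl : Measurable fun x : Plane => planeGaussianPDF σ ‖x‖ := by
    unfold planeGaussianPDF; fun_prop
  have hpos (x : Plane) : 0 ≤ planeGaussianPDF σ ‖x‖ := by
    unfold planeGaussianPDF; positivity
  have inner (x : Plane) : ∫⁻ r, ∫⁻ w, F (measurement x r w, x) ∂(gaussianReal 0 v)
      ∂(gaussianReal 0 vr) = ∫⁻ z, F (z, x) * ((gaussianPDF 0 vr (‖z‖ - ‖x‖) *
        ENNReal.ofReal (wrappedPDF v (angle z - angle x)) + gaussianPDF 0 vr (-‖z‖ - ‖x‖) *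
        ENNReal.ofReal (wrappedPDF v (angle z - angle x + Real.pi))) / ENNReal.ofReal ‖z‖) := by
    rw [← lintegral_smul_unitVec_gaussian hv (g := fun r => gaussianPDF 0 vr (r - ‖x‖))
      (f := fun z => F (z, x)) (by fun_prop) (by fun_prop) (angle x),
      gaussianReal_of_var_ne_zero 0 hvr]
    simp only [measurement_eq]
    rw [lintegral_withDensity_eq_lintegral_mul _ hg (by fun_prop),
      ← lintegral_sub_right_eq_self _ ‖x‖]
    simp
  have hW := (continuous_wrappedPDF hv).measurable
  set L : Plane → Plane → ENNReal := fun x z => F (z, x) * ((gaussianPDF 0 vr (‖z‖ - ‖x‖) *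
    ENNReal.ofReal (wrappedPDF v (angle z - angle x)) + gaussianPDF 0 vr (-‖z‖ - ‖x‖) *
    ENNReal.ofReal (wrappedPDF v (angle z - angle x + Real.pi))) / ENNReal.ofReal ‖z‖) with hL
  have hLm : Measurable fun q : Plane × Plane => L q.1 q.2 := by
    simp only [hL]; fun_prop
  have inner' (x : Plane) : ∫⁻ r, ∫⁻ w, F (measurement x r w, x) ∂(gaussianReal 0 v)
      ∂(gaussianReal 0 vr) = ∫⁻ z, L x z := inner x
  clear_value L
  have hd : Measurable fun x : Plane => ENNReal.ofReal (planeGaussianPDF σ ‖x‖) :=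
    hpl.ennreal_ofReal
  simp only [inner']
  rw [multivariateGaussian_eq_withDensity hσ,
    lintegral_withDensity_eq_lintegral_mul _ hd hLm.lintegral_prod_right]
  simp only [Pi.mul_apply]
  have e1 (x : Plane) := lintegral_const_mul (μ := (volume : Measure Plane))
    (ENNReal.ofReal (planeGaussianPDF σ ‖x‖)) (f := L x) (hLm.comp measurable_prodMk_left)
  have e2 (z : Plane) := lintegral_const_mul (μ := (volume : Measure Plane))
    (ENNReal.ofReal (measurementPDF σ vr z)) (f := fun x : Plane =>
      ENNReal.ofReal (lidarPosterior σ vr v z x) * F (z, x)) (by fun_prop)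
  simp only [← e1, ← e2]
  rw [lintegral_lintegral_swap (((hd.comp measurable_fst).mul hLm).aemeasurable)]
  refine lintegral_congr_ae (ae_ne_zero.mono fun z hz => lintegral_congr fun x => ?_)
  have hz' : 0 < ‖z‖ := norm_pos_iff.2 hz
  have g1 := gaussianPDFReal_nonneg 0 vr (‖z‖ - ‖x‖)
  have g2 := gaussianPDFReal_nonneg 0 vr (-‖z‖ - ‖x‖)
  have g3 := wrappedPDF_nonneg v (angle z - angle x)
  have g4 := wrappedPDF_nonneg v (angle z - angle x + Real.pi)
  simp only [hL, gaussianPDF]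
  rw [← ENNReal.ofReal_mul g1, ← ENNReal.ofReal_mul g2,
    ← ENNReal.ofReal_add (by positivity) (by positivity), ← ENNReal.ofReal_div_of_pos hz',
    mul_left_comm, ← ENNReal.ofReal_mul (hpos x), bayes_formula hσ hvr hz x,
    ENNReal.ofReal_mul (measurementPDF_pos hσ hvr hz).le]
  ring

section JointLaw

variable {Ω : Type*} [MeasurableSpace Ω] {P : Measure Ω}

lemma lintegral_comp_measurement [IsProbabilityMeasure P] {σ : ℝ} (hσ : 0 < σ)
    {vr v : NNReal} (hvr : vr ≠ 0) (hv : v ≠ 0) {X : Ω → Plane} {Vr Vθ : Ω → ℝ}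
    (hXm : Measurable X) (hVrm : Measurable Vr) (hVθm : Measurable Vθ)
    (hX : HasLaw X (multivariateGaussian 0 (σ ^ 2 • (1 : Matrix (Fin 2) (Fin 2) ℝ))) P)
    (hVr : HasLaw Vr (gaussianReal 0 vr) P) (hVθ : HasLaw Vθ (gaussianReal 0 v) P)
    (hVV : IndepFun Vr Vθ P) (hXV : IndepFun X (fun ω => (Vr ω, Vθ ω)) P)
    {Z : Ω → Plane} (hZ : ∀ ω, Z ω = measurement (X ω) (Vr ω) (Vθ ω))
    {F : Plane × Plane → ENNReal} (hF : Measurable F) :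
    ∫⁻ ω, F (Z ω, X ω) ∂P = ∫⁻ z, ENNReal.ofReal (measurementPDF σ vr z) *
      ∫⁻ x, ENNReal.ofReal (lidarPosterior σ vr v z x) * F (z, x) := by
  have h1 := (indepFun_iff_map_prod_eq_prod_map_map hXm.aemeasurable
    (hVrm.prodMk hVθm).aemeasurable).1 hXV
  have h2 := (indepFun_iff_map_prod_eq_prod_map_map hVrm.aemeasurable hVθm.aemeasurable).1 hVV
  rw [h2, hX.map_eq, hVr.map_eq, hVθ.map_eq] at h1
  rw [← lintegral_measurement hσ hvr hv hF]
  have hG : Measurable fun q : Plane × ℝ × ℝ => F (measurement q.1 q.2.1 q.2.2, q.1) := by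
    fun_prop
  have h3 : ∫⁻ ω, F (Z ω, X ω) ∂P = ∫⁻ q, F (measurement q.1 q.2.1 q.2.2, q.1)
      ∂(P.map fun ω => (X ω, Vr ω, Vθ ω)) := by
    rw [lintegral_map hG (by fun_prop)]
    simp only [hZ]
  rw [h3, h1, lintegral_prod _ hG.aemeasurable]
  refine lintegral_congr fun x => ?_
  rw [lintegral_prod _ (by fun_prop)]

variable {σ : ℝ} {vr v : NNReal} {X Z : Ω → Plane}

lemma lintegral_lidarPosterior (hσ : 0 < σ) (hvr : vr ≠ 0) (hv : v ≠ 0) (z : Plane) :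
    ∫⁻ x, ENNReal.ofReal (lidarPosterior σ vr v z x) = 1 := by
  have h := (isProbabilityMeasure_posterior (gain σ vr) (rangeVar_ne_zero hσ hvr) hv z).measure_univ
  rwa [posterior, withDensity_apply _ MeasurableSet.univ, setLIntegral_univ] at h

lemma map_measurement_eq_withDensity (hσ : 0 < σ) (hvr : vr ≠ 0) (hv : v ≠ 0)
    (hZm : Measurable Z)
    (hJ : ∀ F : Plane × Plane → ENNReal, Measurable F → ∫⁻ ω, F (Z ω, X ω) ∂P =
      ∫⁻ z, ENNReal.ofReal (measurementPDF σ vr z) *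
        ∫⁻ x, ENNReal.ofReal (lidarPosterior σ vr v z x) * F (z, x)) :
    P.map Z = volume.withDensity fun z => ENNReal.ofReal (measurementPDF σ vr z) := by
  have hm := (measurable_measurementPDF σ vr).ennreal_ofReal
  refine Measure.ext_of_lintegral _ fun f hf => ?_
  rw [lintegral_map hf hZm, hJ (fun q => f q.1) (by fun_prop),
    lintegral_withDensity_eq_lintegral_mul _ hm hf]
  refine lintegral_congr fun z => ?_
  have hp := (measurable_posteriorDensity_right (gain σ vr) (rangeVar σ vr) hv z).ennreal_ofReal
  simp only [Pi.mul_apply]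
  rw [lintegral_mul_const _ hp, lintegral_lidarPosterior hσ hvr hv z, one_mul]

/-- The density of `Z` is positive off the origin. This turns statements almost sure for the law of
`Z` into Lebesgue almost everywhere ones, to which continuity applies. -/
lemma absolutelyContinuous_map_measurement (hσ : 0 < σ) (hvr : vr ≠ 0) (hv : v ≠ 0)
    (hZm : Measurable Z)
    (hJ : ∀ F : Plane × Plane → ENNReal, Measurable F → ∫⁻ ω, F (Z ω, X ω) ∂P =
      ∫⁻ z, ENNReal.ofReal (measurementPDF σ vr z) *
        ∫⁻ x, ENNReal.ofReal (lidarPosterior σ vr v z x) * F (z, x)) :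
    (volume : Measure Plane) ≪ P.map Z := by
  rw [map_measurement_eq_withDensity hσ hvr hv hZm hJ]
  refine withDensity_absolutelyContinuous'
    (measurable_measurementPDF σ vr).ennreal_ofReal.aemeasurable ?_
  filter_upwards [ae_ne_zero] with z hz
  simpa using measurementPDF_pos hσ hvr hz

variable [IsFiniteMeasure P]

lemma condDistrib_ae_eq_posterior (hσ : 0 < σ) (hvr : vr ≠ 0) (hv : v ≠ 0)
    (hXm : Measurable X) (hZm : Measurable Z)
    (hJ : ∀ F : Plane × Plane → ENNReal, Measurable F → ∫⁻ ω, F (Z ω, X ω) ∂P =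
      ∫⁻ z, ENNReal.ofReal (measurementPDF σ vr z) *
        ∫⁻ x, ENNReal.ofReal (lidarPosterior σ vr v z x) * F (z, x)) :
    ∀ᵐ z ∂(P.map Z), condDistrib X Z P z = posterior (lidarPosterior σ vr v) z := by
  have hp : Measurable (Function.uncurry fun z x : Plane =>
      ENNReal.ofReal (lidarPosterior σ vr v z x)) :=
    (measurable_posteriorDensity (gain σ vr) (rangeVar σ vr) hv).ennreal_ofReal
  let κ : Kernel Plane Plane := Kernel.withDensity (Kernel.const Plane volume)
    fun z x => ENNReal.ofReal (lidarPosterior σ vr v z x)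
  have hκ (z : Plane) : κ z = posterior (lidarPosterior σ vr v) z := by
    simp only [κ]
    rw [Kernel.withDensity_apply _ hp]
    rfl
  have : IsMarkovKernel κ := ⟨fun z => by
    rw [hκ]
    exact isProbabilityMeasure_posterior (gain σ vr) (rangeVar_ne_zero hσ hvr) hv z⟩
  -- A disintegration of the joint law determines the conditional distribution almost surely.
  have hmain : P.map (fun ω => (Z ω, X ω)) = P.map Z ⊗ₘ κ := by
    refine Measure.ext_of_lintegral _ fun F hF => ?_
    rw [lintegral_map hF (by fun_prop), hJ F hF, Measure.lintegral_compProd hF,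
      map_measurement_eq_withDensity hσ hvr hv hZm hJ,
      lintegral_withDensity_eq_lintegral_mul _ (measurable_measurementPDF σ vr).ennreal_ofReal
        hF.lintegral_kernel_prod_right']
    refine lintegral_congr fun z => ?_
    have hpz := (measurable_posteriorDensity_right (gain σ vr) (rangeVar σ vr) hv z).ennreal_ofReal
    simp only [Pi.mul_apply]
    rw [hκ, posterior, lintegral_withDensity_eq_lintegral_mul _ hpz (by fun_prop)]
    simp only [Pi.mul_apply]
  filter_upwards [condDistrib_ae_eq_of_measure_eq_compProd Z hXm.aemeasurable hmain] with z hz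
  rw [hz, hκ]

lemma isPosteriorDensity_lidarPosterior (hσ : 0 < σ) (hvr : vr ≠ 0) (hv : v ≠ 0)
    (hXm : Measurable X) (hZm : Measurable Z)
    (hJ : ∀ F : Plane × Plane → ENNReal, Measurable F → ∫⁻ ω, F (Z ω, X ω) ∂P =
      ∫⁻ z, ENNReal.ofReal (measurementPDF σ vr z) *
        ∫⁻ x, ENNReal.ofReal (lidarPosterior σ vr v z x) * F (z, x)) :
    IsPosteriorDensity P X Z (lidarPosterior σ vr v) where
  nonneg := posteriorDensity_nonneg _ _ _
  continuousOn := continuousOn_posteriorDensity _ (rangeVar_ne_zero hσ hvr) hv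
  lintegral_eq_one z _ := lintegral_lidarPosterior hσ hvr hv z
  condDistrib_eq := condDistrib_ae_eq_posterior hσ hvr hv hXm hZm hJ

lemma IsPosteriorDensity.continuousOn_right {p : Plane → Plane → ℝ}
    (hp : IsPosteriorDensity P X Z p) {z : Plane} (hz : z ≠ 0) : ContinuousOn (p z) {0}ᶜ :=
  hp.continuousOn.comp (f := fun x => (z, x)) (by fun_prop) fun _ hx => ⟨hz, hx⟩

lemma IsPosteriorDensity.continuousOn_left {p : Plane → Plane → ℝ}
    (hp : IsPosteriorDensity P X Z p) {x : Plane} (hx : x ≠ 0) :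
    ContinuousOn (fun z => p z x) {0}ᶜ :=
  hp.continuousOn.comp (f := fun z => (z, x)) (by fun_prop) fun _ hz => ⟨hz, hx⟩

lemma IsPosteriorDensity.aemeasurable {p : Plane → Plane → ℝ}
    (hp : IsPosteriorDensity P X Z p) {z : Plane} (hz : z ≠ 0) : AEMeasurable (p z) := by
  have h := (hp.continuousOn_right hz).aemeasurable (μ := volume) (measurableSet_singleton 0).compl
  rwa [Measure.restrict_eq_self_of_ae_mem (s := {0}ᶜ) ae_ne_zero] at h

/-- For almost every `z` the two densities agree almost everywhere, hence at every `x ≠ 0` by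
continuity in `x`. With `x` fixed, continuity in `z` then removes the exceptional `z`. -/
lemma IsPosteriorDensity.eq_of_ne_zero (hac : (volume : Measure Plane) ≪ P.map Z)
    {p p' : Plane → Plane → ℝ} (hp : IsPosteriorDensity P X Z p)
    (hp' : IsPosteriorDensity P X Z p') {z x : Plane} (hz : z ≠ 0) (hx : x ≠ 0) :
    p' z x = p z x := by
  have hae : ∀ᵐ z : Plane, p' z x = p z x := by
    filter_upwards [hac.ae_le hp.condDistrib_eq, hac.ae_le hp'.condDistrib_eq, ae_ne_zero]
      with y h h' hy
    rw [h, withDensity_eq_iff (hp.aemeasurable hy).ennreal_ofReal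
      (hp'.aemeasurable hy).ennreal_ofReal (by simp [hp.lintegral_eq_one y hy])] at h'
    have h2 : p' y =ᵐ[volume] p y := by
      filter_upwards [h'] with w hw
      exact ((ENNReal.ofReal_eq_ofReal_iff (hp.nonneg _ _) (hp'.nonneg _ _)).1 hw).symm
    exact Measure.eqOn_open_of_ae_eq (ae_restrict_of_ae h2) isOpen_compl_singleton
      (hp'.continuousOn_right hy) (hp.continuousOn_right hy) hx
  exact Measure.eqOn_open_of_ae_eq (f := fun z => p' z x) (g := fun z => p z x)
    (ae_restrict_of_ae hae) isOpen_compl_singleton (hp'.continuousOn_left hx)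
    (hp.continuousOn_left hx) hz

lemma measurable_bayesEstimator (k : ℝ) {τ v : NNReal} (hτ : τ ≠ 0) (hv : v ≠ 0) :
    Measurable (bayesEstimator (posteriorDensity k τ v)) := by
  have hq := (continuous_radialEstimate k hτ v).measurable
  have h : bayesEstimator (posteriorDensity k τ v) =
      fun z => radialEstimate k τ v ‖z‖ • unitVec (angle z) :=
    funext (bayesEstimator_posteriorDensity k hτ hv)
  rw [h]
  fun_prop

lemma condExp_ae_eq_bayesEstimator (hσ : 0 < σ) (hvr : vr ≠ 0) (hv : v ≠ 0)
    (hXm : Measurable X) (hZm : Measurable Z) (hXi : Integrable X P)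
    (hJ : ∀ F : Plane × Plane → ENNReal, Measurable F → ∫⁻ ω, F (Z ω, X ω) ∂P =
      ∫⁻ z, ENNReal.ofReal (measurementPDF σ vr z) *
        ∫⁻ x, ENNReal.ofReal (lidarPosterior σ vr v z x) * F (z, x)) :
    P[X | MeasurableSpace.comap Z inferInstance] =ᵐ[P]
      fun ω => bayesEstimator (lidarPosterior σ vr v) (Z ω) := by
  have h1 := condExp_ae_eq_integral_condDistrib (f := fun x : Plane => x) hZm hXm.aemeasurable
    stronglyMeasurable_id hXi
  have h2 := ae_of_ae_map hZm.aemeasurable (condDistrib_ae_eq_posterior hσ hvr hv hXm hZm hJ)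
  filter_upwards [h1, h2] with ω h h'
  rw [h, h', bayesEstimator_eq_integral_posterior _ _ hv]

end JointLaw

/-! ### Mean squared errors and the distance to the affine estimators. -/

section MeanSquaredError

variable {Ω : Type*} [mΩ : MeasurableSpace Ω] {P : Measure Ω}
  {X Z : Ω → Plane}

lemma integrable_norm_sub_sq {f g : Ω → Plane} (hf : MemLp f 2 P) (hg : MemLp g 2 P) :
    Integrable (fun ω => ‖f ω - g ω‖ ^ 2) P :=
  (hf.sub hg).integrable_norm_pow (by norm_num)

variable [IsProbabilityMeasure P]

lemma memLp_affineEstimator (hZ : MemLp Z 2 P) (a : Plane) (B : Matrix (Fin 2) (Fin 2) ℝ) :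
    MemLp (fun ω => affineEstimator a B (Z ω)) 2 P :=
  (memLp_const a).add ((Matrix.toEuclideanLin B).toContinuousLinearMap.comp_memLp' hZ)

lemma continuous_affineEstimator (a : Plane) (B : Matrix (Fin 2) (Fin 2) ℝ) :
    Continuous (affineEstimator a B) :=
  continuous_const.add (LinearMap.continuous_of_finiteDimensional _)

/-- The Pythagorean identity for estimators that are functions of `Z`. -/
lemma integral_norm_sub_sq_of_condExp {g h : Plane → Plane} (hZm : Measurable Z)
    (hX : MemLp X 2 P) (hgm : Measurable g) (hhm : Measurable h)
    (hg : P[X | MeasurableSpace.comap Z inferInstance] =ᵐ[P] fun ω => g (Z ω))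
    (hg2 : MemLp (fun ω => g (Z ω)) 2 P) (hh2 : MemLp (fun ω => h (Z ω)) 2 P) :
    ∫ ω, ‖X ω - h (Z ω)‖ ^ 2 ∂P =
      ∫ ω, ‖X ω - g (Z ω)‖ ^ 2 ∂P + ∫ ω, ‖g (Z ω) - h (Z ω)‖ ^ 2 ∂P := by
  have hle : MeasurableSpace.comap Z inferInstance ≤ mΩ := hZm.comap_le
  have hXi : Integrable X P := hX.integrable (by norm_num)
  have hgi : Integrable (fun ω => g (Z ω)) P := hg2.integrable (by norm_num)
  have hd2 : MemLp (fun ω => g (Z ω) - h (Z ω)) 2 P := hg2.sub hh2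
  have hr2 : MemLp (fun ω => X ω - g (Z ω)) 2 P := hX.sub hg2
  have hin : Integrable (fun ω => innerSL ℝ (g (Z ω) - h (Z ω)) (X ω - g (Z ω))) P :=
    (hd2.norm.integrable_mul hr2.norm).mono
      (hd2.aestronglyMeasurable.inner hr2.aestronglyMeasurable)
      (ae_of_all _ fun ω => by
        rw [Pi.mul_apply, norm_mul, norm_norm, norm_norm]
        exact norm_inner_le_norm (𝕜 := ℝ) (g (Z ω) - h (Z ω)) (X ω - g (Z ω)))
  have hsm : StronglyMeasurable[MeasurableSpace.comap Z inferInstance]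
      fun ω => g (Z ω) - h (Z ω) :=
    ((hgm.sub hhm).comp (comap_measurable Z)).stronglyMeasurable
  have hsg : StronglyMeasurable[MeasurableSpace.comap Z inferInstance] fun ω => g (Z ω) :=
    (hgm.comp (comap_measurable Z)).stronglyMeasurable
  have hpull := condExp_bilin_of_aestronglyMeasurable_left (innerSL ℝ)
    hsm.aestronglyMeasurable hin (hXi.sub hgi)
  have hsub := condExp_sub hXi hgi (MeasurableSpace.comap Z inferInstance)
  have hgg := condExp_of_stronglyMeasurable hle hsg hgi
  -- The cross term vanishes: the left factor is measurable with respect to `Z` and leaves the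
  -- conditional expectation, where the residual averages to zero.
  have hzero : ∫ ω, innerSL ℝ (g (Z ω) - h (Z ω)) (X ω - g (Z ω)) ∂P = 0 := by
    rw [← integral_condExp hle]
    refine integral_eq_zero_of_ae ?_
    filter_upwards [hpull, hsub, hg] with ω h1 h2 h3
    refine h1.trans ?_
    have : (P[X - fun ω => g (Z ω) | MeasurableSpace.comap Z inferInstance]) ω = 0 := by
      rw [h2, Pi.sub_apply, hgg, h3, sub_self]
    change innerSL ℝ _ ((P[X - fun ω => g (Z ω) | MeasurableSpace.comap Z inferInstance]) ω) = _
    rw [this, map_zero, Pi.zero_apply]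
  have e (ω : Ω) : ‖X ω - h (Z ω)‖ ^ 2 = ‖X ω - g (Z ω)‖ ^ 2 +
      2 * innerSL ℝ (g (Z ω) - h (Z ω)) (X ω - g (Z ω)) + ‖g (Z ω) - h (Z ω)‖ ^ 2 := by
    have : X ω - h (Z ω) = (X ω - g (Z ω)) + (g (Z ω) - h (Z ω)) := by abel
    rw [this, norm_add_sq_real, real_inner_comm]
    rfl
  have i1 := integrable_norm_sub_sq hX hg2
  have i3 := integrable_norm_sub_sq hg2 hh2
  have i12 : Integrable (fun ω => ‖X ω - g (Z ω)‖ ^ 2 +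
      2 * innerSL ℝ (g (Z ω) - h (Z ω)) (X ω - g (Z ω))) P := i1.add (hin.const_mul 2)
  simp only [e]
  rw [integral_add i12 i3, integral_add i1 (hin.const_mul 2), integral_const_mul, hzero]
  ring

/-- The affine estimators as a linear family in `L²`. -/
noncomputable def affineLp (hZ : MemLp Z 2 P) :
    Plane × Matrix (Fin 2) (Fin 2) ℝ →ₗ[ℝ] Lp Plane 2 P where
  toFun aB := (memLp_affineEstimator hZ aB.1 aB.2).toLp _
  map_add' aB cD := by
    rw [← MemLp.toLp_add]
    congr 1
    ext1 ω
    simp only [affineEstimator, Prod.fst_add, Prod.snd_add, map_add, LinearMap.add_apply,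
      Pi.add_apply]
    abel
  map_smul' c aB := by
    rw [RingHom.id_apply, ← MemLp.toLp_const_smul]
    congr 1
    ext1 ω
    simp [affineEstimator]

/-- A function of `Z` that is not affine has positive `L²` distance from the affine ones. -/
lemma exists_pos_le_integral_norm_sub_affineEstimator_sq (hZm : Measurable Z) (hZ : MemLp Z 2 P)
    {g : Plane → Plane} (hgm : Measurable g) (hg2 : MemLp (fun ω => g (Z ω)) 2 P)
    (hg : ∀ a B, ¬ g =ᵐ[P.map Z] affineEstimator a B) :
    ∃ δ, 0 < δ ∧ ∀ a B, δ ≤ ∫ ω, ‖g (Z ω) - affineEstimator a B (Z ω)‖ ^ 2 ∂P := by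
  let K := LinearMap.range (affineLp hZ)
  have hK : IsClosed (K : Set (Lp Plane 2 P)) := Submodule.closed_of_finiteDimensional K
  have hnot : hg2.toLp _ ∉ (K : Set (Lp Plane 2 P)) := by
    rintro ⟨⟨a, B⟩, h⟩
    have h2 := (MemLp.toLp_eq_toLp_iff (memLp_affineEstimator hZ a B) hg2).1 h
    refine hg a B ?_
    rw [Filter.EventuallyEq, ae_map_iff hZm.aemeasurable
      (measurableSet_eq_fun hgm (continuous_affineEstimator a B).measurable)]
    exact h2.symm
  -- A point outside a closed set has positive distance from it; the square of this distance is the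
  -- uniform gap `δ`.
  have hpos : 0 < Metric.infDist (hg2.toLp _) (K : Set (Lp Plane 2 P)) :=
    (hK.notMem_iff_infDist_pos ⟨0, K.zero_mem⟩).1 hnot
  refine ⟨_, pow_pos hpos 2, fun a B => ?_⟩
  have hle : Metric.infDist (hg2.toLp _) (K : Set (Lp Plane 2 P)) ≤
      dist (hg2.toLp _) (affineLp hZ (a, B)) := Metric.infDist_le_dist_of_mem ⟨(a, B), rfl⟩
  have hd := hg2.sub (memLp_affineEstimator hZ a B)
  have he : dist (hg2.toLp _) (affineLp hZ (a, B)) ^ 2 =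
      ∫ ω, ‖g (Z ω) - affineEstimator a B (Z ω)‖ ^ 2 ∂P := by
    rw [dist_eq_norm]
    change ‖hg2.toLp _ - (memLp_affineEstimator hZ a B).toLp _‖ ^ 2 = _
    rw [← MemLp.toLp_sub, ← real_inner_self_eq_norm_sq, L2.inner_def]
    refine integral_congr_ae ?_
    filter_upwards [hd.coeFn_toLp] with ω hω
    rw [hω, real_inner_self_eq_norm_sq]
    rfl
  rw [← he]
  exact pow_le_pow_left₀ hpos.le hle 2

end MeanSquaredError

end Lidar

theorem corollary2 {Ω : Type*} [MeasurableSpace Ω] (P : Measure Ω) [IsProbabilityMeasure P]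
    (σx σr σθ : ℝ) (hσx : 0 < σx) (hσr : 0 < σr) (hσθ : 0 < σθ)
    (X : Ω → Lidar.Plane) (Vr Vθ : Ω → ℝ)
    (hXm : Measurable X) (hVrm : Measurable Vr) (hVθm : Measurable Vθ)
    (hX : HasLaw X (multivariateGaussian 0 (σx ^ 2 • (1 : Matrix (Fin 2) (Fin 2) ℝ))) P)
    (hVr : HasLaw Vr (gaussianReal 0 ⟨σr ^ 2, sq_nonneg σr⟩) P)
    (hVθ : HasLaw Vθ (gaussianReal 0 ⟨σθ ^ 2, sq_nonneg σθ⟩) P)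
    -- `X`, `Vr`, `Vθ` are mutually independent
    (hVV : IndepFun Vr Vθ P) (hXV : IndepFun X (fun ω => (Vr ω, Vθ ω)) P)
    (Z : Ω → Lidar.Plane) (hZ : ∀ ω, Z ω = Lidar.measurement (X ω) (Vr ω) (Vθ ω)) :
    -- the posterior density exists and is unique
    ∃ p : Lidar.Plane → Lidar.Plane → ℝ, Lidar.IsPosteriorDensity P X Z p ∧
      (∀ p', Lidar.IsPosteriorDensity P X Z p' → ∀ z, z ≠ 0 → ∀ x, x ≠ 0 → p' z x = p z x) ∧
      -- for every `z ≠ 0` the posterior is not Gaussian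
      (∀ z, z ≠ 0 → ¬ IsGaussian (Lidar.posterior p z)) ∧
      -- the Bayes estimator `g*` is well defined at every `z ≠ 0`, and `g*(Z) = E[X ∣ Z]`
      (∀ z, z ≠ 0 → Integrable (fun x : Lidar.Plane => p z x • x)) ∧
      (P[X | MeasurableSpace.comap Z inferInstance] =ᵐ[P]
        fun ω => Lidar.bayesEstimator p (Z ω)) ∧
      -- `g*(R u_β) = q(R) u_β`, and `q(R) / R` has different limits at `0` and `∞`
      (∃ q : ℝ → ℝ,
        (∀ R, 0 < R → ∀ β,
          Lidar.bayesEstimator p (R • Lidar.unitVec β) = q R • Lidar.unitVec β) ∧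
        Tendsto (fun R => q R / R) (𝓝[>] 0)
          (𝓝 (2 * (Real.exp (-σθ ^ 2 / 2) * σx ^ 2 / (σx ^ 2 + σr ^ 2)))) ∧
        Tendsto (fun R => q R / R) atTop
          (𝓝 (Real.exp (-σθ ^ 2 / 2) * σx ^ 2 / (σx ^ 2 + σr ^ 2)))) ∧
      -- `g*` is not affine, not even up to null sets of the law of `Z`
      (∀ (a : Lidar.Plane) (B : Matrix (Fin 2) (Fin 2) ℝ),
        ¬ Lidar.bayesEstimator p =ᵐ[P.map Z] Lidar.affineEstimator a B) ∧
      -- the mean squared errors are finite, and there is a strict gap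
      Integrable (fun ω => ‖X ω - Lidar.bayesEstimator p (Z ω)‖ ^ 2) P ∧
      (∀ (a : Lidar.Plane) (B : Matrix (Fin 2) (Fin 2) ℝ),
        Integrable (fun ω => ‖X ω - Lidar.affineEstimator a B (Z ω)‖ ^ 2) P) ∧
      Lidar.mse P X Z (Lidar.bayesEstimator p) <
        ⨅ aB : Lidar.Plane × Matrix (Fin 2) (Fin 2) ℝ,
          Lidar.mse P X Z (Lidar.affineEstimator aB.1 aB.2) := by
  set vr : NNReal := ⟨σr ^ 2, sq_nonneg σr⟩
  set v : NNReal := ⟨σθ ^ 2, sq_nonneg σθ⟩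
  have hvr_coe : (vr : ℝ) = σr ^ 2 := rfl
  have hv_coe : (v : ℝ) = σθ ^ 2 := rfl
  have hvr : vr ≠ 0 := fun h => by
    have : (vr : ℝ) ≠ 0 := by rw [hvr_coe]; positivity
    exact this (by simp [h])
  have hv : v ≠ 0 := fun h => by
    have : (v : ℝ) ≠ 0 := by rw [hv_coe]; positivity
    exact this (by simp [h])
  have hτ := Lidar.rangeVar_ne_zero hσx hvr
  have hk := Lidar.gain_pos hσx vr
  have hZm : Measurable Z := by
    have : Z = fun ω => Lidar.measurement (X ω) (Vr ω) (Vθ ω) := funext hZ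
    rw [this]
    exact Lidar.measurable_measurement.comp (f := fun ω => (X ω, Vr ω, Vθ ω)) (by fun_prop)
  have hJ (F : Lidar.Plane × Lidar.Plane → ENNReal) (hF : Measurable F) :=
    Lidar.lintegral_comp_measurement hσx hvr hv hXm hVrm hVθm hX hVr hVθ hVV hXV hZ hF
  have hX2 : MemLp X 2 P := by
    have h := IsGaussian.memLp_two_id
      (μ := multivariateGaussian 0 (σx ^ 2 • (1 : Matrix (Fin 2) (Fin 2) ℝ)))
    rw [← hX.map_eq, memLp_map_measure_iff (by fun_prop) hXm.aemeasurable] at h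
    exact h
  have hVr2 : MemLp Vr 2 P := by
    have h := memLp_id_gaussianReal (μ := 0) (v := vr) 2
    rw [← hVr.map_eq, memLp_map_measure_iff (by fun_prop) hVrm.aemeasurable] at h
    exact h
  have hZ2 : MemLp Z 2 P := by
    refine (hX2.norm.add hVr2).of_le hZm.aestronglyMeasurable (ae_of_all _ fun ω => ?_)
    rw [hZ, Lidar.measurement_eq, norm_smul, Lidar.norm_unitVec, mul_one]
    rfl
  have hp := Lidar.isPosteriorDensity_lidarPosterior hσx hvr hv hXm hZm hJ
  have hac := Lidar.absolutelyContinuous_map_measurement hσx hvr hv hZm hJ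
  have hce := Lidar.condExp_ae_eq_bayesEstimator hσx hvr hv hXm hZm
    (hX2.integrable (by norm_num)) hJ
  have hgm := Lidar.measurable_bayesEstimator (Lidar.gain σx vr) hτ hv
  -- Square integrability comes from that of `X`, since conditional expectation preserves `L²`.
  have hg2 : MemLp (fun ω => Lidar.bayesEstimator (Lidar.lidarPosterior σx vr v) (Z ω)) 2 P :=
    (hX2.condExp (by norm_num)).ae_eq hce
  have hna (a : Lidar.Plane) (B : Matrix (Fin 2) (Fin 2) ℝ) :
      ¬ Lidar.bayesEstimator (Lidar.lidarPosterior σx vr v) =ᵐ[P.map Z]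
        Lidar.affineEstimator a B :=
    fun h => Lidar.not_ae_eq_affineEstimator hk hτ hv a B (hac.ae_le h)
  have hc : Real.exp (-(v / 2)) * Lidar.gain σx vr =
      Real.exp (-σθ ^ 2 / 2) * σx ^ 2 / (σx ^ 2 + σr ^ 2) := by
    rw [Lidar.gain, hvr_coe, hv_coe, neg_div, mul_div_assoc]
  refine ⟨Lidar.lidarPosterior σx vr v, hp,
    fun p' hp' z hz x hx => Lidar.IsPosteriorDensity.eq_of_ne_zero hac hp hp' hz hx,
    fun z _ => Lidar.not_isGaussian_posterior _ hτ hv z,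
    fun z _ => Lidar.integrable_posteriorDensity_smul _ hτ hv z, hce,
    ⟨Lidar.radialEstimate (Lidar.gain σx vr) (Lidar.rangeVar σx vr) v,
      fun R hR β => Lidar.bayesEstimator_smul_unitVec _ hτ hv hR β,
      hc ▸ Lidar.tendsto_radialEstimate_div_zero hk hτ v,
      hc ▸ Lidar.tendsto_radialEstimate_div_atTop hk hτ v⟩, hna,
    Lidar.integrable_norm_sub_sq hX2 hg2,
    fun a B => Lidar.integrable_norm_sub_sq hX2 (Lidar.memLp_affineEstimator hZ2 a B), ?_⟩
  obtain ⟨δ, hδ, hle⟩ :=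
    Lidar.exists_pos_le_integral_norm_sub_affineEstimator_sq hZm hZ2 hgm hg2 hna
  -- The uniform `δ` is inserted between the two sides, so the inequality stays strict after taking
  -- the infimum.
  refine (lt_add_of_pos_right _ hδ).trans_le (le_ciInf fun aB => ?_)
  rw [Lidar.mse, Lidar.mse, Lidar.integral_norm_sub_sq_of_condExp hZm hX2 hgm
    (Lidar.continuous_affineEstimator aB.1 aB.2).measurable hce hg2
    (Lidar.memLp_affineEstimator hZ2 aB.1 aB.2)]
  gcongr
  exact hle aB.1 aB.2
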